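/- Let $n\ge 1$. Let $X\subset(\mathbb R^n)^{n+1}$ be the space of labeled nondegenerate $n$-simplices in $\mathbb R^n$ (affinely independent tuples $x=(x_0,\dots,x_n)$), with the Euclidean metric of $(\mathbb R^n)^{n+1}$; let $X/S_{n+1}$ be the space of unlabeled simplices, with the quotient topology; and let $\mathrm{Vol}(x)$ and $r(x)$ be the volume and the inradius of the simplex $x$. A simplex is regular if every permutation of its vertices is induced by an isometry of $\mathbb R^n$. Let $g$ be a smooth real function on $(0,\infty)$ with $g'>0$ (for instance $g(r)=r$, or $g(r)=$ the volume of an $n$-ball of radius $r$). Then $\mathrm{Vol}$ and $r$ are smooth on $X$ and $\nabla\mathrm{Vol}$ vanishes nowhere on $X$. Let $F(x)$ be the gradient of $g\circ r$ constrained to fixed volume, that is, the orthogonal projection of $\nabla (g\circ r)(x)$ onto the orthogonal complement of $\nabla \mathrm{Vol}(x)$. The equation $\dot x=F(x)$ has, for every initial simplex $x\in X$, exactly one solution $t\mapsto\varphi_t(x)\in X$ on $[0,\infty)$, and the flow $\varphi$ has the following properties. 1. $\mathrm{Vol}(\varphi_t(x))=\mathrm{Vol}(x)$ for all $t\ge 0$,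 and if $x$ is not regular, then $r(\varphi_t(x))$ is strictly increasing in $t$. The flow commutes with the isometries of $\mathbb R^n$. 2. For every $x\in X$, $\varphi_t(x)$ converges, as $t\to\infty$, to a single regular simplex $\rho(x)\in X$. 3. The flow gives a strong deformation retraction of the space of unlabeled simplices onto the space of regular simplices: there is a continuous map $H:[0,1]\times X/S_{n+1}\to X/S_{n+1}$ with $H(s,[x])=[\varphi_{s/(1-s)}(x)]$ for $0\le s<1$ and $H(1,[x])=[\rho(x)]$ for all $x\in X$; it satisfies $H(0,q)=q$ and $H(1,q)$ is regular for all $q$, and $H(s,q)=q$ for all $s$ whenever $q$ is regular. -/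

import Mathlib

open Set Filter Topology MeasureTheory
open scoped NNReal unitInterval ContDiff

noncomputable section

namespace SimplexFlow

/-- Ordered `(n + 1)`-tuples of points of Euclidean space `ℝⁿ`, as the Euclidean space
`ℝ^((n + 1) × n)`: the entry `(i, j)` is the `j`-th coordinate of the `i`-th point. -/
abbrev Config (n : ℕ) : Type :=
  EuclideanSpace ℝ (Fin (n + 1) × Fin n)

/-- The points of a tuple. -/
def vertex {n : ℕ} (x : Config n) (i : Fin (n + 1)) : EuclideanSpace ℝ (Fin n) :=
  WithLp.toLp 2 fun j => x (i, j)

/-- The space of labeled nondegenerate `n`-simplices in `ℝⁿ`, a subspace of `Config n`. -/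
abbrev LabeledSimplex (n : ℕ) : Type :=
  {x : Config n // AffineIndependent ℝ (vertex x)}

/-- A labeled simplex as a simplex in the sense of Mathlib. -/
def LabeledSimplex.toSimplex {n : ℕ} (x : LabeledSimplex n) :
    Affine.Simplex ℝ (EuclideanSpace ℝ (Fin n)) n :=
  ⟨vertex x.1, x.2⟩

/-- All vertices are interchangeable by isometries of `ℝⁿ`. -/
def LabeledSimplex.IsRegular {n : ℕ} (x : LabeledSimplex n) : Prop :=
  x.toSimplex.Regular

/-- The `n`-dimensional volume of the convex hull of the vertices. -/
def vol {n : ℕ} (x : Config n) : ℝ :=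
  (volume : Measure (EuclideanSpace ℝ (Fin n))).real (convexHull ℝ (range (vertex x)))

open Classical in
/-- The inradius, as a function on all of `Config n` (with value `0` at the degenerate tuples), so
that its gradient can be taken at the points of the open set of simplices. -/
def inradius {n : ℕ} [NeZero n] (x : Config n) : ℝ :=
  if h : AffineIndependent ℝ (vertex x) then
    Affine.Simplex.inradius (⟨vertex x, h⟩ : Affine.Simplex ℝ (EuclideanSpace ℝ (Fin n)) n)
  else 0

/-- The gradient at `x` of `g ∘ inradius` restricted to the hypersurface of constant volume through
`x`: the orthogonal projection of the gradient onto the orthogonal complement of `∇ vol x`. -/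
def inflationField {n : ℕ} [NeZero n] (g : ℝ → ℝ) (x : Config n) : Config n :=
  (Submodule.span ℝ {gradient (vol (n := n)) x})ᗮ.starProjection
    (gradient (fun y : Config n => g (inradius y)) x)

/-- `γ : [0, ∞) → LabeledSimplex n` is an integral curve of `inflationField g`
(with a one-sided derivative at time `0`). -/
def IsFlowLine {n : ℕ} [NeZero n] (g : ℝ → ℝ) (γ : ℝ≥0 → LabeledSimplex n) : Prop :=
  ∀ t : ℝ≥0, HasDerivWithinAt (fun s : ℝ => (γ s.toNNReal).1)
    (inflationField g (γ t).1) (Ici 0) (t : ℝ)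

/-- Two labeled simplices are equivalent if they differ by a permutation of the labels. -/
instance relabeling (n : ℕ) : Setoid (LabeledSimplex n) where
  r x y := ∃ e : Equiv.Perm (Fin (n + 1)), ∀ i, vertex y.1 i = vertex x.1 (e i)
  iseqv :=
    { refl := fun _ => ⟨1, fun _ => rfl⟩
      symm := fun {x _} h => by
        obtain ⟨e, he⟩ := h
        exact ⟨e⁻¹, fun i => by rw [he]; simp⟩
      trans := fun {_ _ _} h h' => by
        obtain ⟨e, he⟩ := h
        obtain ⟨e', he'⟩ := h'
        exact ⟨e * e', fun i => by rw [he', he]; rfl⟩ }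

/-- The space of unlabeled `n`-simplices in `ℝⁿ`, with the quotient topology. -/
abbrev UnlabeledSimplex (n : ℕ) : Type :=
  Quotient (relabeling n)

/-- The unlabeled simplex underlying a labeled one. -/
def unlabel {n : ℕ} (x : LabeledSimplex n) : UnlabeledSimplex n :=
  Quotient.mk (relabeling n) x

/-- The subspace of regular unlabeled simplices (of any size and position). -/
def regularSimplices (n : ℕ) : Set (UnlabeledSimplex n) :=
  unlabel '' {x : LabeledSimplex n | x.IsRegular}

end SimplexFlow

end

/-! Write `b i` for the gradients of the barycentric coordinates (`dualVec`). They satisfy `∑ b i =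
0` and `∑ b i ⊗ x i = 1`, and `‖b i‖` is the inverse of the `i`-th height. So the inradius is `1 /
f` with `f = ∑ ‖b i‖` (`invInradius`), the gradient of log-volume is the tuple `(b i)`, and the
gradient of `-f` is the tuple `(T (b i))`, where `T = ∑ b k ⊗ b k / ‖b k‖` has trace `f`. The flow
is thus, up to a positive factor, gradient descent of `f` at fixed volume.

The squared Frobenius norm of the traceless part of `T` is `shapeDefect`, which vanishes exactly at
the regular simplices (`LabeledSimplex.isRegular_iff`). Testing the field against the traceless part
of `T` applied to the vertices bounds `shapeDefect` by the squared field (`shapeDefect_le`). On the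
other hand, the normalized Gram matrix `Y` of the vectors `(‖b i‖ / √n, b i)` has trace `n + 1`,
lies at squared distance `(n / f)² * shapeDefect` from the identity, and yields the isoperimetric
deficit as `-log det Y - ∑ log (Y i i)`. Concavity of the logarithm makes the deficit nonnegative,
and its second-order expansion at the identity bounds the deficit by a multiple of `shapeDefect`
(`deficit_nonneg`, `deficit_le`). Together these give a Łojasiewicz inequality with exponent `1/2`:
locally, `deficit ≤ C * ‖field‖²` (`deficit_le_inflationField`).

The flow fixes the determinant and the center of gravity and does not increase `f`, and bounds on
these three cut out a compact set of simplices. Hence trajectories exist for all time. The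
Łojasiewicz inequality makes the deficit decay exponentially and gives the trajectories finite
length, with constants uniform near each initial simplex (`exists_exponential_rate`). Limits are
stationary, hence regular. Local uniformity makes the flow, completed by its limit at infinite time,
continuous; equivariance under relabeling lets it descend to the quotient. -/

noncomputable section

namespace SimplexFlow

/-! ### Homogeneous coordinates and the gradients of the barycentric coordinates -/

variable {n : ℕ}

/-- The tuple with given vertices. -/
def ofVertices (p : Fin (n + 1) → EuclideanSpace ℝ (Fin n)) : Config n :=
  WithLp.toLp 2 fun ij => p ij.1 ij.2

@[simp]
theorem vertex_ofVertices (p : Fin (n + 1) → EuclideanSpace ℝ (Fin n)) (i : Fin (n + 1)) :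
    vertex (ofVertices p) i = p i := rfl

@[simp]
theorem ofVertices_vertex (x : Config n) : ofVertices (vertex x) = x := rfl

theorem config_ext {x y : Config n} (h : ∀ i, vertex x i = vertex y i) : x = y := by
  rw [← ofVertices_vertex x, ← ofVertices_vertex y, funext h]

@[simp] theorem vertex_apply (x : Config n) (i : Fin (n + 1)) (j : Fin n) :
    vertex x i j = x (i, j) := rfl

@[simp] theorem vertex_add (x y : Config n) (i : Fin (n + 1)) :
    vertex (x + y) i = vertex x i + vertex y i := rfl

@[simp] theorem vertex_sub (x y : Config n) (i : Fin (n + 1)) :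
    vertex (x - y) i = vertex x i - vertex y i := rfl

@[simp] theorem vertex_smul (c : ℝ) (x : Config n) (i : Fin (n + 1)) :
    vertex (c • x) i = c • vertex x i := rfl

@[simp] theorem vertex_zero (i : Fin (n + 1)) :
    vertex (0 : Config n) i = 0 := rfl

theorem inner_euclidean {ι : Type*} [Fintype ι] (x y : EuclideanSpace ℝ ι) :
    inner ℝ x y = ∑ i, x i * y i := by
  rw [PiLp.inner_apply]
  exact Finset.sum_congr rfl fun i _ => by simp [mul_comm]

theorem inner_config (x y : Config n) :
    inner ℝ x y = ∑ i, inner ℝ (vertex x i) (vertex y i) := by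
  simp [inner_euclidean, Fintype.sum_prod_type]

theorem norm_sq_config (x : Config n) : ‖x‖ ^ 2 = ∑ i, ‖vertex x i‖ ^ 2 := by
  simp_rw [← real_inner_self_eq_norm_sq]
  exact inner_config x x

/-- The `i`-th vertex as a linear function of the tuple. -/
def vertexL (i : Fin (n + 1)) : Config n →L[ℝ] EuclideanSpace ℝ (Fin n) :=
  LinearMap.toContinuousLinearMap
    { toFun := fun x => vertex x i
      map_add' := fun _ _ => rfl
      map_smul' := fun _ _ => rfl }

/-- The square matrix whose rows are the homogeneous coordinates `(1, xᵢ)` of the vertices. -/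
def homMatrix (x : Config n) : Matrix (Fin (n + 1)) (Fin (n + 1)) ℝ :=
  Matrix.of fun i k => Fin.cases 1 (fun j => x (i, j)) k

@[simp] theorem homMatrix_zero (x : Config n) (i : Fin (n + 1)) : homMatrix x i 0 = 1 := rfl

@[simp] theorem homMatrix_succ (x : Config n) (i : Fin (n + 1)) (j : Fin n) :
    homMatrix x i j.succ = x (i, j) := rfl

/-- The signed volume, times `n!`. -/
def homDet (x : Config n) : ℝ := (homMatrix x).det

/-- The gradients of the barycentric coordinates. -/
def dualVec (x : Config n) (i : Fin (n + 1)) : EuclideanSpace ℝ (Fin n) :=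
  WithLp.toLp 2 fun j => (homMatrix x)⁻¹ j.succ i

@[simp] theorem dualVec_apply (x : Config n) (i : Fin (n + 1)) (j : Fin n) :
    dualVec x i j = (homMatrix x)⁻¹ j.succ i := rfl

/-- The left kernel of the homogeneous matrix is the space of affine dependencies of the vertices.
-/
theorem affineIndependent_iff_homDet_ne_zero (x : Config n) :
    AffineIndependent ℝ (vertex x) ↔ homDet x ≠ 0 := by
  have key : ∀ w : Fin (n + 1) → ℝ, Matrix.vecMul w (homMatrix x) = 0 ↔
      ∑ i, w i = 0 ∧ ∑ i, w i • vertex x i = 0 := by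
    intro w
    rw [funext_iff, Fin.forall_fin_succ]
    refine and_congr ?_ ?_
    · simp [Matrix.vecMul, dotProduct]
    · rw [PiLp.ext_iff]
      simp [Matrix.vecMul, dotProduct]
  rw [homDet, Ne, ← Matrix.exists_vecMul_eq_zero_iff, affineIndependent_iff_of_fintype]
  constructor
  · rintro h ⟨w, hw, hw'⟩
    obtain ⟨h1, h2⟩ := (key w).1 hw'
    refine hw (funext fun i => h w h1 ?_ i)
    rwa [Finset.weightedVSub_eq_linear_combination _ h1]
  · intro h w h1 h2
    rw [Finset.weightedVSub_eq_linear_combination _ h1] at h2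
    by_contra! hne
    obtain ⟨i, hi⟩ := hne
    exact h ⟨w, fun h0 => hi (by simp [h0]), (key w).2 ⟨h1, h2⟩⟩

theorem isUnit_homMatrix_det {x : Config n} (hx : homDet x ≠ 0) : IsUnit (homMatrix x).det :=
  isUnit_iff_ne_zero.2 hx

section dual

variable {x : Config n} (hx : homDet x ≠ 0)

include hx

theorem sum_dualVec : ∑ i, dualVec x i = 0 := by
  ext j
  have h := congrFun (congrFun (Matrix.nonsing_inv_mul _ (isUnit_homMatrix_det hx)) j.succ) 0
  simpa [Matrix.mul_apply] using h

theorem sum_dualVec_mul_vertex (a c : Fin n) :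
    ∑ i, dualVec x i a * vertex x i c = if a = c then 1 else 0 := by
  have h := congrFun (congrFun (Matrix.nonsing_inv_mul _ (isUnit_homMatrix_det hx)) a.succ) c.succ
  simpa [Matrix.mul_apply, Matrix.one_apply] using h

theorem sum_inner_dualVec_smul_vertex (p : EuclideanSpace ℝ (Fin n)) :
    ∑ i, inner ℝ (dualVec x i) p • vertex x i = p := by
  ext c
  have : ∀ i, (∑ a, dualVec x i a * p a) * vertex x i c
      = ∑ a, p a * (dualVec x i a * vertex x i c) := fun i => by
    rw [Finset.sum_mul]; exact Finset.sum_congr rfl fun a _ => by ring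
  simp only [WithLp.ofLp_sum, WithLp.ofLp_smul, Finset.sum_apply, Pi.smul_apply, smul_eq_mul,
    inner_euclidean, this]
  rw [Finset.sum_comm]
  simp_rw [← Finset.mul_sum, sum_dualVec_mul_vertex hx]
  simp

theorem sum_inner_vertex_smul_dualVec (p : EuclideanSpace ℝ (Fin n)) :
    ∑ i, inner ℝ (vertex x i) p • dualVec x i = p := by
  ext c
  have : ∀ i, (∑ a, vertex x i a * p a) * dualVec x i c
      = ∑ a, p a * (dualVec x i c * vertex x i a) := fun i => by
    rw [Finset.sum_mul]; exact Finset.sum_congr rfl fun a _ => by ring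
  simp only [WithLp.ofLp_sum, WithLp.ofLp_smul, Finset.sum_apply, Pi.smul_apply, smul_eq_mul,
    inner_euclidean, this]
  rw [Finset.sum_comm]
  simp_rw [← Finset.mul_sum, sum_dualVec_mul_vertex hx]
  simp

theorem inner_dualVec_vertex_sub (i j k : Fin (n + 1)) :
    inner ℝ (dualVec x j) (vertex x i - vertex x k) =
      (if i = j then 1 else 0) - (if k = j then 1 else 0) := by
  have h : ∀ i, (homMatrix x)⁻¹ 0 j + inner ℝ (dualVec x j) (vertex x i)
      = if i = j then 1 else 0 := fun i => by
    have h := congrFun (congrFun (Matrix.mul_nonsing_inv _ (isUnit_homMatrix_det hx)) i) j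
    rw [Matrix.mul_apply, Fin.sum_univ_succ, Matrix.one_apply] at h
    rw [← h, inner_euclidean]
    simp [mul_comm]
  rw [inner_sub_right, ← h i, ← h k]
  ring

/-- The edges at one vertex span the space, so pairings with them determine a vector. This is how
dual vectors are recognized in every geometric description below. -/
theorem eq_dualVec_of_inner_vertex_sub {j : Fin (n + 1)} {p : EuclideanSpace ℝ (Fin n)}
    (hp : ∀ i, inner ℝ p (vertex x i - vertex x j) = (if i = j then 1 else 0) - 1) :
    p = dualVec x j := by
  rw [← sub_eq_zero, ← sum_inner_vertex_smul_dualVec hx (p - dualVec x j)]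
  have : ∀ i, inner ℝ (vertex x i) (p - dualVec x j)
      = inner ℝ (vertex x j) (p - dualVec x j) := fun i => by
    rw [← sub_eq_zero, ← inner_sub_left, inner_sub_right, real_inner_comm, hp,
      real_inner_comm, inner_dualVec_vertex_sub hx]
    simp
  simp_rw [this, ← Finset.smul_sum, sum_dualVec hx, smul_zero]

theorem dualVec_ne_zero [NeZero n] (i : Fin (n + 1)) : dualVec x i ≠ 0 := by
  intro h
  have : Nontrivial (Fin (n + 1)) := Fin.nontrivial_iff_two_le.2 (by have := NeZero.pos n; omega)
  obtain ⟨k, hk⟩ := exists_ne i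
  have := inner_dualVec_vertex_sub hx i i k
  simp [h, hk] at this

end dual

/-! ### The inradius as a smooth function -/

/-- The sum of the lengths of the gradients of the barycentric coordinates: the inverse of the
inradius. -/
def invInradius (x : Config n) : ℝ := ∑ i, ‖dualVec x i‖

theorem invInradius_pos [NeZero n] {x : Config n} (hx : homDet x ≠ 0) : 0 < invInradius x :=
  Finset.sum_pos (fun i _ => norm_pos_iff.2 (dualVec_ne_zero hx i)) Finset.univ_nonempty

/-- The altitude vector divided by the square of its length has the pairings that characterize the
dual vector. -/
theorem norm_dualVec_eq_inv_height [NeZero n] {x : Config n} (h : AffineIndependent ℝ (vertex x))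
    (i : Fin (n + 1)) :
    ‖dualVec x i‖ = ((⟨vertex x, h⟩ : Affine.Simplex ℝ (EuclideanSpace ℝ (Fin n)) n).height i)⁻¹ := by
  set s : Affine.Simplex ℝ (EuclideanSpace ℝ (Fin n)) n := ⟨vertex x, h⟩ with hs
  have hpos := s.height_pos i
  have : (s.height i ^ 2)⁻¹ • (s.points i - s.altitudeFoot i) = dualVec x i := by
    refine eq_dualVec_of_inner_vertex_sub ((affineIndependent_iff_homDet_ne_zero x).1 h) ?_
    intro k
    rw [inner_smul_left]
    rcases eq_or_ne k i with rfl | hk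
    · simp
    · have h1 := s.inner_vsub_vsub_altitudeFoot_eq_height_sq hk.symm
      have h2 : inner ℝ (s.points i - s.altitudeFoot i) (vertex x k - vertex x i)
          = - s.height i ^ 2 := by
        rw [← h1, real_inner_comm, ← inner_neg_left]
        simp [hs]
      rw [h2]
      simp only [hk, if_false, conj_trivial]
      field_simp
      norm_num
  rw [← this, norm_smul, ← dist_eq_norm]
  change _ * s.height i = _
  rw [Real.norm_of_nonneg (by positivity)]
  field_simp

theorem inradius_eq_inv [NeZero n] {x : Config n} (hx : homDet x ≠ 0) :
    inradius x = (invInradius x)⁻¹ := by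
  have h := (affineIndependent_iff_homDet_ne_zero x).2 hx
  rw [inradius, dif_pos h, Affine.Simplex.inradius_eq_abs_inv_sum]
  simp_rw [Affine.Simplex.excenterWeightsUnnorm_empty_apply, ← norm_dualVec_eq_inv_height h]
  exact abs_of_pos (inv_pos.2 (invInradius_pos hx))

theorem contDiff_homMatrix_apply (i k : Fin (n + 1)) :
    ContDiff ℝ ∞ fun x : Config n => homMatrix x i k := by
  refine Fin.cases ?_ (fun j => ?_) k
  · simp only [homMatrix_zero]; fun_prop
  · simp only [homMatrix_succ]; fun_prop

theorem contDiff_det_of_contDiff {m : ℕ} {A : Config n → Matrix (Fin m) (Fin m) ℝ}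
    (hA : ∀ i j, ContDiff ℝ ∞ fun x => A x i j) : ContDiff ℝ ∞ fun x => (A x).det := by
  simp_rw [Matrix.det_apply]
  refine ContDiff.sum fun τ _ => ?_
  refine ContDiff.const_smul _ (contDiff_prod fun i _ => hA _ _)

theorem contDiff_homDet : ContDiff ℝ ∞ (homDet (n := n)) :=
  contDiff_det_of_contDiff contDiff_homMatrix_apply

theorem isOpen_homDet_ne_zero : IsOpen {x : Config n | homDet x ≠ 0} :=
  isOpen_ne.preimage contDiff_homDet.continuous

/-- By Cramer's rule the entry is a polynomial divided by `homDet`. -/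
theorem contDiffAt_inv_homMatrix_apply {x : Config n} (hx : homDet x ≠ 0) (i j : Fin (n + 1)) :
    ContDiffAt ℝ ∞ (fun x : Config n => (homMatrix x)⁻¹ i j) x := by
  have : (fun x : Config n => (homMatrix x)⁻¹ i j)
      = fun x => (homDet x)⁻¹ * ((homMatrix x).updateRow j (Pi.single i 1)).det := by
    ext x
    rw [Matrix.inv_def, Matrix.smul_apply, Matrix.adjugate_apply, Ring.inverse_eq_inv', smul_eq_mul,
      homDet]
  rw [this]
  refine (contDiff_homDet.contDiffAt.inv hx).mul (contDiff_det_of_contDiff fun k l => ?_).contDiffAt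
  simp only [Matrix.updateRow_apply]
  split_ifs
  · fun_prop
  · exact contDiff_homMatrix_apply k l

theorem contDiffAt_dualVec {x : Config n} (hx : homDet x ≠ 0) (i : Fin (n + 1)) :
    ContDiffAt ℝ ∞ (fun x : Config n => dualVec x i) x :=
  contDiffAt_euclidean.2 fun j => contDiffAt_inv_homMatrix_apply hx j.succ i

theorem contDiffAt_invInradius [NeZero n] {x : Config n} (hx : homDet x ≠ 0) :
    ContDiffAt ℝ ∞ (invInradius (n := n)) x :=
  ContDiffAt.sum fun i _ => (contDiffAt_dualVec hx i).norm ℝ (dualVec_ne_zero hx i)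

theorem contDiffAt_inradius [NeZero n] {x : Config n} (hx : homDet x ≠ 0) :
    ContDiffAt ℝ ∞ (inradius (n := n)) x := by
  refine ((contDiffAt_invInradius hx).inv (invInradius_pos hx).ne').congr_of_eventuallyEq ?_
  filter_upwards [isOpen_homDet_ne_zero.mem_nhds hx] with y hy using inradius_eq_inv hy

end SimplexFlow

end

/-! ### Gradients of the volume and the inradius -/

noncomputable section

namespace SimplexFlow

variable {n : ℕ}

/-- Once differentiability is known, directional derivatives identify the gradient, so each
computation below takes place on a line. -/
theorem hasGradientAt_of_hasDerivAt_line {E : Type*} [NormedAddCommGroup E]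
    [InnerProductSpace ℝ E] [CompleteSpace E] {f : E → ℝ} {w x : E} (hf : DifferentiableAt ℝ f x)
    (h : ∀ v, HasDerivAt (fun s : ℝ => f (x + s • v)) (inner ℝ w v) 0) : HasGradientAt f w x := by
  rw [hasGradientAt_iff_hasFDerivAt]
  refine hf.hasFDerivAt.congr_fderiv (ContinuousLinearMap.ext fun v => ?_)
  have h1 : HasLineDerivAt ℝ f (fderiv ℝ f x v) x v := hf.hasFDerivAt.hasLineDerivAt v
  exact h1.unique (h v)

theorem homMatrix_add_smul {x : Config n} (hx : homDet x ≠ 0) (v : Config n) (s : ℝ) :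
    homMatrix (x + s • v) = homMatrix x *
      (1 + s • Matrix.of fun k l => Fin.cases 0 (fun c => ∑ i, (homMatrix x)⁻¹ k i * v (i, c)) l) := by
  have key : homMatrix x * (Matrix.of fun k l : Fin (n + 1) =>
      (Fin.cases 0 (fun c => ∑ i, (homMatrix x)⁻¹ k i * v (i, c)) l : ℝ)) =
      Matrix.of fun i l => (Fin.cases 0 (fun c => v (i, c)) l : ℝ) := by
    have : (Matrix.of fun k l : Fin (n + 1) =>
        (Fin.cases 0 (fun c => ∑ i, (homMatrix x)⁻¹ k i * v (i, c)) l : ℝ)) =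
        (homMatrix x)⁻¹ * Matrix.of fun i l => (Fin.cases 0 (fun c => v (i, c)) l : ℝ) := by
      ext k l
      refine Fin.cases ?_ (fun c => ?_) l <;> simp [Matrix.mul_apply]
    rw [this, ← Matrix.mul_assoc, Matrix.mul_nonsing_inv _ (isUnit_homMatrix_det hx), Matrix.one_mul]
  rw [Matrix.mul_add, Matrix.mul_one, Matrix.mul_smul, key]
  ext i l
  refine Fin.cases ?_ (fun c => ?_) l <;> simp

/-- Jacobi's formula: `det (1 + s M) = 1 + s tr M + O(s²)`, where the trace pairs the dual vectors
with the velocities. -/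
theorem hasDerivAt_homDet_line {x : Config n} (hx : homDet x ≠ 0) (v : Config n) :
    HasDerivAt (fun s : ℝ => homDet (x + s • v))
      (homDet x * ∑ i, inner ℝ (dualVec x i) (vertex v i)) 0 := by
  set M : Matrix (Fin (n + 1)) (Fin (n + 1)) ℝ := Matrix.of fun k l =>
    Fin.cases 0 (fun c => ∑ i, (homMatrix x)⁻¹ k i * v (i, c)) l with hM
  have htr : M.trace = ∑ i, inner ℝ (dualVec x i) (vertex v i) := by
    rw [Matrix.trace, Fin.sum_univ_succ]
    simp only [inner_euclidean, hM]
    rw [Finset.sum_comm]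
    simp
  set p : Polynomial ℝ := (1 + (Polynomial.X : Polynomial ℝ) • M.map Polynomial.C).det.divX.divX with hp
  have : (fun s : ℝ => homDet (x + s • v)) =
      fun s => homDet x * (1 + M.trace * s + p.eval s * s ^ 2) := by
    ext s
    rw [homDet, homMatrix_add_smul hx, Matrix.det_mul, Matrix.det_one_add_smul]
    rfl
  rw [this, ← htr]
  have h1 : HasDerivAt (fun s : ℝ => 1 + M.trace * s + p.eval s * s ^ 2)
      (M.trace * 1 + (p.derivative.eval 0 * 0 ^ 2 + p.eval 0 * (((2 : ℕ) : ℝ) * 0 ^ (2 - 1) * 1))) 0 := by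
    refine HasDerivAt.add (((hasDerivAt_id' (0 : ℝ)).const_mul M.trace).const_add 1) ?_
    exact (p.hasDerivAt 0).mul ((hasDerivAt_id' (0 : ℝ)).pow 2)
  simpa using h1.const_mul (homDet x)

/-- The gradient of the logarithm of the volume. -/
def dualConfig (x : Config n) : Config n := ofVertices (dualVec x)

@[simp] theorem vertex_dualConfig (x : Config n) (i : Fin (n + 1)) :
    vertex (dualConfig x) i = dualVec x i := rfl

theorem hasGradientAt_homDet {x : Config n} (hx : homDet x ≠ 0) :
    HasGradientAt homDet (homDet x • dualConfig x) x := by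
  refine hasGradientAt_of_hasDerivAt_line
    (contDiff_homDet.differentiable (by simp)).differentiableAt fun v => ?_
  refine (hasDerivAt_homDet_line hx v).congr_deriv ?_
  simp [inner_smul_left, inner_config]

/-- The linear part of the affine map that takes the vertices of `x` to those of `y`. -/
def transferMatrix (x y : Config n) : Matrix (Fin n) (Fin n) ℝ :=
  Matrix.of fun a c => ∑ i, vertex y i a * dualVec x i c

theorem toLpLin_transferMatrix (x y : Config n) (p : EuclideanSpace ℝ (Fin n)) :
    Matrix.toLpLin 2 2 (transferMatrix x y) p = ∑ i, inner ℝ (dualVec x i) p • vertex y i := by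
  ext a
  simp only [Matrix.toLpLin_apply, Matrix.mulVec, dotProduct, transferMatrix, Matrix.of_apply,
    WithLp.ofLp_sum, WithLp.ofLp_smul, Finset.sum_apply, Pi.smul_apply, smul_eq_mul,
    inner_euclidean, Finset.sum_mul]
  rw [Finset.sum_comm]
  exact Finset.sum_congr rfl fun _ _ => Finset.sum_congr rfl fun _ _ => by ring

/-- The matrix `(homMatrix x)⁻¹ * homMatrix y` has first column `(1, 0, …, 0)`, and the
complementary block is the transpose of the transfer matrix. -/
theorem det_transferMatrix {x : Config n} (hx : homDet x ≠ 0) (y : Config n) :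
    (transferMatrix x y).det = homDet y / homDet x := by
  set M := (homMatrix x)⁻¹ * homMatrix y with hM
  have hdet : M.det = homDet y / homDet x := by
    rw [hM, Matrix.det_mul, Matrix.det_nonsing_inv, Ring.inverse_eq_inv', homDet, homDet]
    field_simp
  have h0 : ∀ k, M k 0 = if k = 0 then 1 else 0 := by
    intro k
    have h := congrFun (congrFun (Matrix.nonsing_inv_mul _ (isUnit_homMatrix_det hx)) k) 0
    simpa [Matrix.mul_apply, Matrix.one_apply, hM] using h
  rw [← hdet, Matrix.det_succ_column_zero, Finset.sum_eq_single 0 (fun k _ hk => by simp [h0, hk])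
    (by simp), ← Matrix.det_transpose]
  simp only [h0, if_true, Fin.val_zero, pow_zero, one_mul]
  congr 1
  ext a c
  simp [hM, transferMatrix, Matrix.mul_apply, mul_comm]

-- The simplex `y` is the image of `x` under an affine map. Comparing volumes in this way avoids
-- computing the factor `1 / n!`.
open scoped Pointwise in
theorem vol_eq_mul {x : Config n} (hx : homDet x ≠ 0) (y : Config n) :
    vol y = |homDet y / homDet x| * vol x := by
  set A : EuclideanSpace ℝ (Fin n) →ₗ[ℝ] EuclideanSpace ℝ (Fin n) :=
    Matrix.toLpLin 2 2 (transferMatrix x y) with hA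
  have hsub : ∀ i, vertex y i = (vertex y 0 - A (vertex x 0)) + A (vertex x i) := by
    intro i
    have : A (vertex x i) - A (vertex x 0) = vertex y i - vertex y 0 := by
      rw [← map_sub, hA, toLpLin_transferMatrix]
      simp_rw [inner_dualVec_vertex_sub hx, sub_smul, Finset.sum_sub_distrib]
      simp
    rw [eq_add_of_sub_eq this.symm]
    abel
  have hr : convexHull ℝ (range (vertex y)) =
      (vertex y 0 - A (vertex x 0)) +ᵥ (A '' convexHull ℝ (range (vertex x))) := by
    rw [LinearMap.image_convexHull, ← convexHull_vadd, ← range_comp]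
    congr 1
    rw [← Set.image_vadd, ← range_comp]
    congr 1
    exact funext hsub
  rw [vol, hr, measureReal_def, measure_vadd, Measure.addHaar_image_linearMap, LinearMap.det_toLpLin,
    det_transferMatrix hx, ENNReal.toReal_mul, ENNReal.toReal_ofReal (abs_nonneg _), vol,
    measureReal_def]

theorem vol_pos {x : Config n} (hx : homDet x ≠ 0) : 0 < vol x := by
  have h := (affineIndependent_iff_homDet_ne_zero x).2 hx
  have hne : (interior (convexHull ℝ (range (vertex x)))).Nonempty := by
    rw [interior_convexHull_nonempty_iff_affineSpan_eq_top,
      h.affineSpan_eq_top_iff_card_eq_finrank_add_one]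
    simp
  refine ENNReal.toReal_pos ?_ ?_
  · exact (Measure.measure_pos_of_nonempty_interior _ hne).ne'
  · exact ((finite_range _).isCompact_convexHull ℝ).measure_lt_top.ne

/-- The sign of the determinant is locally constant, which removes the absolute value. -/
theorem vol_eventuallyEq {x : Config n} (hx : homDet x ≠ 0) :
    vol =ᶠ[𝓝 x] fun y => vol x / homDet x * homDet y := by
  have h1 : ∀ᶠ y in 𝓝 x, 0 < homDet y / homDet x := by
    refine ((contDiff_homDet.continuous.div_const _).tendsto x).eventually_const_lt ?_
    simp [hx]
  filter_upwards [h1] with y hy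
  rw [vol_eq_mul hx y, abs_of_pos hy]
  ring

theorem contDiffAt_vol {x : Config n} (hx : homDet x ≠ 0) : ContDiffAt ℝ ∞ (vol (n := n)) x :=
  (contDiff_const.mul contDiff_homDet).contDiffAt.congr_of_eventuallyEq (vol_eventuallyEq hx)

theorem hasGradientAt_vol {x : Config n} (hx : homDet x ≠ 0) :
    HasGradientAt vol (vol x • dualConfig x) x := by
  have h := (hasGradientAt_iff_hasFDerivAt.1 (hasGradientAt_homDet hx)).const_mul (vol x / homDet x)
  rw [hasGradientAt_iff_hasFDerivAt]
  refine (h.congr_of_eventuallyEq (vol_eventuallyEq hx)).congr_fderiv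
    (ContinuousLinearMap.ext fun v => ?_)
  simp
  field_simp

theorem dualConfig_ne_zero [NeZero n] {x : Config n} (hx : homDet x ≠ 0) : dualConfig x ≠ 0 := by
  intro h
  exact dualVec_ne_zero hx 0 (by rw [← vertex_dualConfig, h, vertex_zero])

/-- Pairings of dual vectors with edges are constant; differentiating them gives the pairings of the
unknown derivative with the edges, which determine it. -/
theorem hasDerivAt_dualVec_line {x : Config n} (hx : homDet x ≠ 0) (v : Config n)
    (j : Fin (n + 1)) :
    HasDerivAt (fun s : ℝ => dualVec (x + s • v) j)
      (-∑ i, inner ℝ (dualVec x j) (vertex v i) • dualVec x i) 0 := by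
  have hline : HasDerivAt (fun s : ℝ => x + s • v) v 0 := by
    simpa using ((hasDerivAt_id' (0 : ℝ)).smul_const v).const_add x
  have hdiff : HasFDerivAt (fun y => dualVec y j) (fderiv ℝ (fun y => dualVec y j) x)
      (x + (0 : ℝ) • v) := by
    simpa using ((contDiffAt_dualVec hx j).differentiableAt (by simp)).hasFDerivAt
  have hd := hdiff.comp_hasDerivAt (0 : ℝ) hline
  set d := fderiv ℝ (fun y => dualVec y j) x v with hd_def
  have hev : ∀ᶠ s : ℝ in 𝓝 0, homDet (x + s • v) ≠ 0 := by
    have : Tendsto (fun s : ℝ => x + s • v) (𝓝 0) (𝓝 x) := by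
      simpa using hline.continuousAt.tendsto
    exact this.eventually (isOpen_homDet_ne_zero.mem_nhds hx)
  have key : ∀ i k, inner ℝ d (vertex x i - vertex x k)
      = -inner ℝ (dualVec x j) (vertex v i - vertex v k) := by
    intro i k
    have h1 : HasDerivAt (fun s : ℝ => vertex (x + s • v) i - vertex (x + s • v) k)
        (vertex v i - vertex v k) 0 :=
      ((vertexL i - vertexL k : Config n →L[ℝ] _).hasFDerivAt).comp_hasDerivAt (0 : ℝ) hline
    have h2 := HasDerivAt.inner ℝ hd h1
    have h3 := h2.unique ((hasDerivAt_const (0 : ℝ)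
      (((if i = j then 1 else 0) - (if k = j then 1 else 0) : ℝ))).congr_of_eventuallyEq ?_)
    · simp only [Function.comp_apply, zero_smul, add_zero] at h3
      linarith
    · filter_upwards [hev] with s hs
      exact inner_dualVec_vertex_sub hs i j k
  refine hd.congr_deriv ?_
  have h0 : ∀ c : ℝ, ∑ i, c • dualVec x i = 0 := fun c => by
    rw [← Finset.smul_sum, sum_dualVec hx, smul_zero]
  have e1 : d = ∑ i, inner ℝ d (vertex x i - vertex x 0) • dualVec x i := by
    simp_rw [inner_sub_right, sub_smul, Finset.sum_sub_distrib, h0, sub_zero]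
    conv_lhs => rw [← sum_inner_vertex_smul_dualVec hx d]
    simp_rw [real_inner_comm]
  rw [e1]
  simp_rw [key, inner_sub_right, neg_sub, sub_smul, Finset.sum_sub_distrib, h0, zero_sub]

/-- The gradient of `-invInradius`. -/
def pullConfig (x : Config n) : Config n :=
  ofVertices fun i => ∑ j, (inner ℝ (dualVec x j) (dualVec x i) / ‖dualVec x j‖) • dualVec x j

theorem vertex_pullConfig (x : Config n) (i : Fin (n + 1)) : vertex (pullConfig x) i =
    ∑ j, (inner ℝ (dualVec x j) (dualVec x i) / ‖dualVec x j‖) • dualVec x j := rfl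

theorem hasGradientAt_invInradius [NeZero n] {x : Config n} (hx : homDet x ≠ 0) :
    HasGradientAt invInradius (-pullConfig x) x := by
  refine hasGradientAt_of_hasDerivAt_line
    ((contDiffAt_invInradius hx).differentiableAt (by simp)) fun v => ?_
  have h : ∀ j, HasDerivAt (fun s : ℝ => ‖dualVec (x + s • v) j‖)
      (-∑ i, inner ℝ (dualVec x j) (vertex v i) * inner ℝ (dualVec x j) (dualVec x i)
        / ‖dualVec x j‖) 0 := by
    intro j
    have hne : ‖dualVec x j‖ ≠ 0 := norm_ne_zero_iff.2 (dualVec_ne_zero hx j)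
    have h1 := (hasDerivAt_dualVec_line hx v j).norm_sq.sqrt (by simp [dualVec_ne_zero hx j])
    simp only [Real.sqrt_sq (norm_nonneg _), zero_smul, add_zero, inner_neg_right, inner_sum,
      inner_smul_right] at h1
    refine h1.congr_deriv ?_
    rw [mul_neg, neg_div, mul_div_mul_left _ _ two_ne_zero, Finset.sum_div]
  refine (HasDerivAt.fun_sum fun j (_ : j ∈ Finset.univ) => h j).congr_deriv ?_
  rw [inner_neg_left, inner_config, Finset.sum_neg_distrib, neg_inj, Finset.sum_comm]
  refine Finset.sum_congr rfl fun i _ => ?_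
  rw [vertex_pullConfig, sum_inner]
  refine Finset.sum_congr rfl fun j _ => ?_
  rw [inner_smul_left, conj_trivial]
  ring

theorem inradius_eventuallyEq [NeZero n] {x : Config n} (hx : homDet x ≠ 0) :
    inradius =ᶠ[𝓝 x] fun y => (invInradius y)⁻¹ := by
  filter_upwards [isOpen_homDet_ne_zero.mem_nhds hx] with y hy using inradius_eq_inv hy

theorem inradius_pos [NeZero n] {x : Config n} (hx : homDet x ≠ 0) : 0 < inradius x := by
  rw [inradius_eq_inv hx]
  exact inv_pos.2 (invInradius_pos hx)

theorem hasGradientAt_inradius [NeZero n] {x : Config n} (hx : homDet x ≠ 0) :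
    HasGradientAt inradius (inradius x ^ 2 • pullConfig x) x := by
  rw [hasGradientAt_iff_hasFDerivAt]
  have h := (hasDerivAt_inv (invInradius_pos hx).ne').comp_hasFDerivAt x
    (hasGradientAt_iff_hasFDerivAt.1 (hasGradientAt_invInradius hx))
  refine (h.congr_of_eventuallyEq (inradius_eventuallyEq hx)).congr_fderiv
    (ContinuousLinearMap.ext fun v => ?_)
  simp [inradius_eq_inv hx]

/-- The component of `pullConfig x` orthogonal to the gradient of the volume. -/
def constrainedPull (x : Config n) : Config n :=
  pullConfig x - (inner ℝ (dualConfig x) (pullConfig x) / ‖dualConfig x‖ ^ 2) • dualConfig x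

theorem inner_dualConfig_constrainedPull (x : Config n) :
    inner ℝ (dualConfig x) (constrainedPull x) = 0 := by
  rcases eq_or_ne (dualConfig x) 0 with h | h
  · simp [h]
  · have : ‖dualConfig x‖ ≠ 0 := norm_ne_zero_iff.2 h
    rw [constrainedPull, inner_sub_right, inner_smul_right, real_inner_self_eq_norm_sq]
    field_simp
    ring

theorem inner_pullConfig_constrainedPull (x : Config n) :
    inner ℝ (pullConfig x) (constrainedPull x) = ‖constrainedPull x‖ ^ 2 := by
  have h : pullConfig x = constrainedPull x
      + (inner ℝ (dualConfig x) (pullConfig x) / ‖dualConfig x‖ ^ 2) • dualConfig x := by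
    rw [constrainedPull]; abel
  rw [h, inner_add_left, inner_smul_left, inner_dualConfig_constrainedPull,
    real_inner_self_eq_norm_sq, mul_zero, add_zero]

section field

variable [NeZero n] {g : ℝ → ℝ}

/-- The volume gradient is a nonzero multiple of `dualConfig x`, so both span the same line. The
choice of `g` enters only through a positive scalar factor. -/
theorem inflationField_eq (hg : ContDiffOn ℝ ∞ g (Ioi 0)) {x : Config n} (hx : homDet x ≠ 0) :
    inflationField g x = (deriv g (inradius x) * inradius x ^ 2) • constrainedPull x := by
  have hr := inradius_pos hx
  have hgd : HasDerivAt g (deriv g (inradius x)) (inradius x) :=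
    ((hg.contDiffAt (Ioi_mem_nhds hr)).differentiableAt (by simp)).hasDerivAt
  have hgrad : HasGradientAt (fun y : Config n => g (inradius y))
      ((deriv g (inradius x) * inradius x ^ 2) • pullConfig x) x := by
    rw [hasGradientAt_iff_hasFDerivAt]
    refine (hgd.comp_hasFDerivAt x (hasGradientAt_iff_hasFDerivAt.1
      (hasGradientAt_inradius hx))).congr_fderiv (ContinuousLinearMap.ext fun v => ?_)
    simp [mul_assoc]
  have hspan : Submodule.span ℝ {gradient (vol (n := n)) x} = Submodule.span ℝ {dualConfig x} := by
    rw [(hasGradientAt_vol hx).gradient,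
      Submodule.span_singleton_smul_eq (isUnit_iff_ne_zero.2 (vol_pos hx).ne')]
  have hproj : ∀ (K K' : Submodule ℝ (Config n)), K = K' →
      ∀ v, Kᗮ.starProjection v = K'ᗮ.starProjection v := by
    rintro K _ rfl v; rfl
  rw [inflationField, hproj _ _ hspan, hgrad.gradient, map_smul,
    Submodule.starProjection_orthogonal_val, Submodule.starProjection_singleton]
  rfl

theorem contDiffAt_constrainedPull {x : Config n} (hx : homDet x ≠ 0) :
    ContDiffAt ℝ ∞ (constrainedPull (n := n)) x := by
  have hof : ∀ {p : Config n → Fin (n + 1) → EuclideanSpace ℝ (Fin n)},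
      (∀ i, ContDiffAt ℝ ∞ (fun y => p y i) x) → ContDiffAt ℝ ∞ (fun y => ofVertices (p y)) x := by
    intro p hp
    exact contDiffAt_euclidean.2 fun ij => contDiffAt_euclidean.1 (hp ij.1) ij.2
  have hb : ∀ i, ContDiffAt ℝ ∞ (fun y : Config n => dualVec y i) x := contDiffAt_dualVec hx
  have h1 : ContDiffAt ℝ ∞ (dualConfig (n := n)) x := hof hb
  have h2 : ContDiffAt ℝ ∞ (pullConfig (n := n)) x := hof fun i => ContDiffAt.sum fun j _ =>
    (((hb j).inner ℝ (hb i)).div ((hb j).norm ℝ (dualVec_ne_zero hx j))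
      (norm_ne_zero_iff.2 (dualVec_ne_zero hx j))).smul (hb j)
  exact h2.sub (((h1.inner ℝ h2).div (h1.norm_sq ℝ)
    (pow_ne_zero 2 (norm_ne_zero_iff.2 (dualConfig_ne_zero hx)))).smul h1)

theorem contDiffAt_inflationField (hg : ContDiffOn ℝ ∞ g (Ioi 0)) {x : Config n}
    (hx : homDet x ≠ 0) : ContDiffAt ℝ 1 (inflationField (n := n) g) x := by
  have hr := inradius_pos hx
  have hdg : ContDiffAt ℝ ∞ (deriv g) (inradius x) :=
    ((contDiffOn_infty_iff_deriv_of_isOpen isOpen_Ioi).1 hg).2.contDiffAt (Ioi_mem_nhds hr)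
  have hi := contDiffAt_inradius hx
  have : ContDiffAt ℝ ∞ (inflationField (n := n) g) x := by
    refine ContDiffAt.congr_of_eventuallyEq
      (((hdg.comp x hi).mul (hi.pow 2)).smul (contDiffAt_constrainedPull hx)) ?_
    filter_upwards [isOpen_homDet_ne_zero.mem_nhds hx] with y hy using inflationField_eq hg hy
  exact this.of_le (by exact_mod_cast le_top)

end field

end SimplexFlow

end

/-! ### The isoperimetric deficit and its second-order upper bound -/

noncomputable section

namespace SimplexFlow

section logBounds

variable {ι : Type*} [Fintype ι]

theorem sum_log_nonpos {y : ι → ℝ} (hy : ∀ i, 0 < y i) (hsum : ∑ i, y i = Fintype.card ι) :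
    ∑ i, Real.log (y i) ≤ 0 := by
  calc ∑ i, Real.log (y i) ≤ ∑ i, (y i - 1) :=
        Finset.sum_le_sum fun i _ => Real.log_le_sub_one_of_pos (hy i)
    _ = 0 := by simp [hsum]

/-- For `y ≥ 1/2` one has `-log y ≤ (1 - y) + 2 (y - 1)²`, and the linear terms cancel in the sum.
-/
theorem neg_sum_log_le {y : ι → ℝ} (hsum : ∑ i, y i = Fintype.card ι)
    (hsmall : ∑ i, (y i - 1) ^ 2 ≤ 1 / 4) :
    -∑ i, Real.log (y i) ≤ 2 * ∑ i, (y i - 1) ^ 2 := by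
  have hhalf : ∀ i, 1 / 2 ≤ y i := by
    intro i
    have h1 : (y i - 1) ^ 2 ≤ 1 / 4 :=
      (Finset.single_le_sum (f := fun i => (y i - 1) ^ 2) (fun _ _ => sq_nonneg _)
        (Finset.mem_univ i)).trans hsmall
    nlinarith [abs_le_of_sq_le_sq' (h1.trans (by norm_num : (1 / 4 : ℝ) ≤ (1 / 2) ^ 2)) (by norm_num)]
  have h : ∀ i, -Real.log (y i) ≤ (1 - y i) + 2 * (y i - 1) ^ 2 := by
    intro i
    have hpos : 0 < y i := lt_of_lt_of_le (by norm_num) (hhalf i)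
    have h1 := Real.one_sub_inv_le_log_of_pos hpos
    have h2 : (y i)⁻¹ = 1 + (1 - y i) + (y i)⁻¹ * (y i - 1) ^ 2 := by field_simp; ring
    have h3 : (y i)⁻¹ ≤ 2 := by
      rw [inv_le_comm₀ hpos two_pos]; linarith [hhalf i]
    have h4 := mul_le_mul_of_nonneg_right h3 (sq_nonneg (y i - 1))
    linarith
  rw [← Finset.sum_neg_distrib]
  refine (Finset.sum_le_sum fun i _ => h i).trans_eq ?_
  rw [Finset.sum_add_distrib, ← Finset.mul_sum]
  simp [hsum]

variable [DecidableEq ι]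

theorem sum_sq_sub_one {Y : Matrix ι ι ℝ} :
    ∑ i, ∑ j, (Y i j - (1 : Matrix ι ι ℝ) i j) ^ 2
      = ∑ i, ∑ j, Y i j ^ 2 - 2 * Y.trace + Fintype.card ι := by
  have h : ∀ i, ∑ j, (Y i j - (1 : Matrix ι ι ℝ) i j) ^ 2 = ∑ j, Y i j ^ 2 - 2 * Y i i + 1 := by
    intro i
    have : ∀ j, (Y i j - (1 : Matrix ι ι ℝ) i j) ^ 2
        = Y i j ^ 2 - (if i = j then 2 * Y i j - 1 else 0) := by
      intro j
      rw [Matrix.one_apply]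
      split_ifs <;> ring
    simp_rw [this, Finset.sum_sub_distrib]
    simp
    ring
  simp_rw [h, Finset.sum_add_distrib, Finset.sum_sub_distrib, ← Finset.mul_sum]
  simp [Matrix.trace]

/-- Both sides expand in terms of the traces of `Y` and `Y²`. -/
theorem sum_eigenvalues_sub_one_sq {Y : Matrix ι ι ℝ} (hY : Y.IsHermitian) :
    ∑ i, (hY.eigenvalues i - 1) ^ 2 = ∑ i, ∑ j, (Y i j - (1 : Matrix ι ι ℝ) i j) ^ 2 := by
  have h2 : ∑ i, hY.eigenvalues i ^ 2 = ∑ i, ∑ j, Y i j ^ 2 := by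
    have e1 : (Y * Y).trace = ∑ i, ∑ j, Y i j ^ 2 := by
      simp only [Matrix.trace, Matrix.diag, Matrix.mul_apply]
      refine Finset.sum_congr rfl fun i _ => Finset.sum_congr rfl fun j _ => ?_
      rw [sq]
      congr 1
      simpa using hY.apply i j
    rw [← e1]
    conv_rhs => rw [hY.spectral_theorem, ← map_mul, Unitary.conjStarAlgAut_apply,
      Matrix.trace_mul_cycle, Unitary.coe_star_mul_self, Matrix.one_mul, Matrix.diagonal_mul_diagonal,
      Matrix.trace_diagonal]
    simp [sq]
  have h1 := hY.trace_eq_sum_eigenvalues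
  rw [sum_sq_sub_one, ← h2, h1]
  simp only [sub_sq, Finset.sum_add_distrib, Finset.sum_sub_distrib, mul_one, ← Finset.mul_sum]
  simp

theorem log_det_eq_sum {Y : Matrix ι ι ℝ} (hY : Y.PosDef) :
    Real.log Y.det = ∑ i, Real.log (hY.isHermitian.eigenvalues i) := by
  rw [hY.isHermitian.det_eq_prod_eigenvalues, ← Real.log_prod]
  · rfl
  · exact fun i _ => (hY.eigenvalues_pos i).ne'

theorem log_det_nonpos {Y : Matrix ι ι ℝ} (hY : Y.PosDef) (htr : Y.trace = Fintype.card ι) :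
    Real.log Y.det ≤ 0 := by
  rw [log_det_eq_sum hY]
  refine sum_log_nonpos hY.eigenvalues_pos ?_
  rw [← htr, hY.isHermitian.trace_eq_sum_eigenvalues]
  rfl

theorem neg_log_det_le {Y : Matrix ι ι ℝ} (hY : Y.PosDef) (htr : Y.trace = Fintype.card ι)
    (hsmall : ∑ i, ∑ j, (Y i j - (1 : Matrix ι ι ℝ) i j) ^ 2 ≤ 1 / 4) :
    -Real.log Y.det ≤ 2 * ∑ i, ∑ j, (Y i j - (1 : Matrix ι ι ℝ) i j) ^ 2 := by
  rw [log_det_eq_sum hY, ← sum_eigenvalues_sub_one_sq hY.isHermitian]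
  refine neg_sum_log_le ?_ (by rwa [sum_eigenvalues_sub_one_sq hY.isHermitian])
  rw [← htr, hY.isHermitian.trace_eq_sum_eigenvalues]
  rfl

end logBounds

variable {n : ℕ}

/-- The dual Gram matrix, normalized so that it is the identity exactly at regular simplices. -/
def normGram (x : Config n) : Matrix (Fin (n + 1)) (Fin (n + 1)) ℝ :=
  Matrix.of fun i j => n / invInradius x *
    ((inner ℝ (dualVec x i) (dualVec x j) + ‖dualVec x i‖ * ‖dualVec x j‖ / n)
      / (√‖dualVec x i‖ * √‖dualVec x j‖))

/-- A nonnegative quantity that vanishes exactly at regular simplices. -/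
def shapeDefect (x : Config n) : ℝ :=
  ∑ i, ∑ j, inner ℝ (dualVec x i) (dualVec x j) ^ 2 / (‖dualVec x i‖ * ‖dualVec x j‖)
    - invInradius x ^ 2 / n

/-- The logarithmic isoperimetric deficit. -/
def deficit (x : Config n) : ℝ :=
  2 * n * Real.log (invInradius x) - Real.log (n ^ n * (n + 1) ^ (n + 1) / homDet x ^ 2)

section

variable [NeZero n] {x : Config n} (hx : homDet x ≠ 0)

include hx

-- Multiplied by the homogeneous matrix, this matrix gets first column `(f, 0, …, 0)` and lower
-- right block the identity, since `∑ b i = 0` and `∑ b i ⊗ x i = 1`.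
omit [NeZero n] in
theorem det_dualVec_norm :
    (Matrix.of fun k i => Fin.cases ‖dualVec x i‖ (fun a => dualVec x i a) k :
      Matrix (Fin (n + 1)) (Fin (n + 1)) ℝ).det = invInradius x / homDet x := by
  set A : Matrix (Fin (n + 1)) (Fin (n + 1)) ℝ :=
    Matrix.of fun k i => Fin.cases ‖dualVec x i‖ (fun a => dualVec x i a) k with hA
  have h0 : ∀ k, (A * homMatrix x) k 0 = if k = 0 then invInradius x else 0 := by
    refine Fin.cases ?_ fun a => ?_
    · simp [Matrix.mul_apply, hA, invInradius]
    · have h := congrArg (fun p : EuclideanSpace ℝ (Fin n) => p a) (sum_dualVec hx)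
      simpa [Matrix.mul_apply, hA] using h
  have hdet : (A * homMatrix x).det = invInradius x := by
    rw [Matrix.det_succ_column_zero,
      Finset.sum_eq_single 0 (fun k _ hk => by simp [h0, hk]) (by simp)]
    have : (A * homMatrix x).submatrix (Fin.succAbove 0) Fin.succ = 1 := by
      ext a c
      rw [Matrix.one_apply, ← sum_dualVec_mul_vertex hx a c]
      simp [Matrix.mul_apply, hA]
    rw [this]
    simp [h0]
  rw [eq_div_iff hx, ← hdet, Matrix.det_mul, homDet]

/-- This exhibits `normGram x` as the Gram matrix of rescaled vectors `(‖b i‖ / √n, b i)`. It yields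
both positive definiteness and the determinant. -/
theorem normGram_factor : normGram x = Matrix.conjTranspose (Matrix.of fun k i =>
      (Fin.cases (√(n / invInradius x) / √n) (fun _ => √(n / invInradius x)) k : ℝ) *
        ((√‖dualVec x i‖)⁻¹ * (Matrix.of fun k i =>
          Fin.cases ‖dualVec x i‖ (fun a => dualVec x i a) k :
            Matrix (Fin (n + 1)) (Fin (n + 1)) ℝ) k i)) *
      (Matrix.of fun k i =>
      (Fin.cases (√(n / invInradius x) / √n) (fun _ => √(n / invInradius x)) k : ℝ) *
        ((√‖dualVec x i‖)⁻¹ * (Matrix.of fun k i =>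
          Fin.cases ‖dualVec x i‖ (fun a => dualVec x i a) k :
            Matrix (Fin (n + 1)) (Fin (n + 1)) ℝ) k i)) := by
  have hf := invInradius_pos hx
  have hn : (0 : ℝ) < n := by exact_mod_cast NeZero.pos n
  ext i j
  have h1 : √(n / invInradius x) * √(n / invInradius x) = n / invInradius x :=
    Real.mul_self_sqrt (by positivity)
  have h2 : √(n : ℝ) * √(n : ℝ) = n := Real.mul_self_sqrt hn.le
  have hsn : √(n : ℝ) ≠ 0 := (Real.sqrt_pos.2 hn).ne'
  have hi : √‖dualVec x i‖ ≠ 0 := (Real.sqrt_pos.2 (norm_pos_iff.2 (dualVec_ne_zero hx i))).ne'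
  have hj : √‖dualVec x j‖ ≠ 0 := (Real.sqrt_pos.2 (norm_pos_iff.2 (dualVec_ne_zero hx j))).ne'
  simp only [normGram, Matrix.of_apply, Matrix.mul_apply, Matrix.conjTranspose_apply, star_trivial,
    Fin.sum_univ_succ, Fin.cases_zero, Fin.cases_succ]
  have e1 : ∀ a, √(n / invInradius x) * ((√‖dualVec x i‖)⁻¹ * dualVec x i a) *
      (√(n / invInradius x) * ((√‖dualVec x j‖)⁻¹ * dualVec x j a))
      = n / invInradius x / (√‖dualVec x i‖ * √‖dualVec x j‖) * (dualVec x i a * dualVec x j a) := by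
    intro a
    calc _ = √(n / invInradius x) * √(n / invInradius x) / (√‖dualVec x i‖ * √‖dualVec x j‖) *
          (dualVec x i a * dualVec x j a) := by field_simp
      _ = _ := by rw [h1]
  simp_rw [e1, ← Finset.mul_sum, ← inner_euclidean]
  have e2 : √(n / invInradius x) / √n * ((√‖dualVec x i‖)⁻¹ * ‖dualVec x i‖) *
      (√(n / invInradius x) / √n * ((√‖dualVec x j‖)⁻¹ * ‖dualVec x j‖))
      = n / invInradius x * (‖dualVec x i‖ * ‖dualVec x j‖ / n
          / (√‖dualVec x i‖ * √‖dualVec x j‖)) := by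
    calc _ = (√(n / invInradius x) * √(n / invInradius x)) / (√n * √n) *
          (‖dualVec x i‖ * ‖dualVec x j‖ / (√‖dualVec x i‖ * √‖dualVec x j‖)) := by field_simp
      _ = _ := by rw [h1, h2]; ring
  rw [e2]
  ring

theorem det_normGram : (normGram x).det = (n / invInradius x) ^ (n + 1) / n *
    (invInradius x / homDet x) ^ 2 / ∏ i, ‖dualVec x i‖ := by
  have hf := invInradius_pos hx
  have hn : (0 : ℝ) < n := by exact_mod_cast NeZero.pos n
  rw [normGram_factor hx, Matrix.det_mul, Matrix.det_conjTranspose, star_trivial, ← sq]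
  have := Matrix.det_mul_column (fun k : Fin (n + 1) =>
    (Fin.cases (√(n / invInradius x) / √n) (fun _ => √(n / invInradius x)) k : ℝ))
    (Matrix.of fun k i => (√‖dualVec x i‖)⁻¹ * (Matrix.of fun k i =>
          Fin.cases ‖dualVec x i‖ (fun a => dualVec x i a) k :
            Matrix (Fin (n + 1)) (Fin (n + 1)) ℝ) k i)
  simp only [Matrix.of_apply] at this
  simp only [Matrix.of_apply]
  rw [this]
  have h2 := Matrix.det_mul_row (fun i => (√‖dualVec x i‖)⁻¹) (Matrix.of fun k i =>
          Fin.cases ‖dualVec x i‖ (fun a => dualVec x i a) k :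
            Matrix (Fin (n + 1)) (Fin (n + 1)) ℝ)
  simp only [Matrix.of_apply] at h2
  rw [h2, det_dualVec_norm hx, mul_pow, mul_pow, ← Finset.prod_pow, ← Finset.prod_pow,
    Fin.prod_univ_succ]
  have h3 : ∀ i, ((√‖dualVec x i‖)⁻¹) ^ 2 = ‖dualVec x i‖⁻¹ := fun i => by
    rw [inv_pow, Real.sq_sqrt (norm_nonneg _)]
  simp only [h3, Fin.cases_zero, Fin.cases_succ, div_pow, Real.sq_sqrt hn.le,
    Finset.prod_inv_distrib, Finset.prod_const, Finset.card_univ, Fintype.card_fin]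
  rw [Real.sq_sqrt (by positivity)]
  ring

theorem normGram_diag (i : Fin (n + 1)) :
    normGram x i i = (n + 1) * ‖dualVec x i‖ / invInradius x := by
  have hi := norm_pos_iff.2 (dualVec_ne_zero hx i)
  have hf := invInradius_pos hx
  have hn : (0 : ℝ) < n := by exact_mod_cast NeZero.pos n
  simp only [normGram, Matrix.of_apply, real_inner_self_eq_norm_sq, Real.mul_self_sqrt hi.le]
  field_simp

theorem trace_normGram : (normGram x).trace = Fintype.card (Fin (n + 1)) := by
  have hf := invInradius_pos hx
  simp only [Matrix.trace, Matrix.diag, normGram_diag hx, ← Finset.sum_div, ← Finset.mul_sum]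
  rw [← invInradius]
  field_simp
  simp

theorem posDef_normGram : (normGram x).PosDef := by
  have hf := invInradius_pos hx
  have hn : (0 : ℝ) < n := by exact_mod_cast NeZero.pos n
  have hdet : (normGram x).det ≠ 0 := by
    rw [det_normGram hx]
    have : ∏ i, ‖dualVec x i‖ ≠ 0 :=
      Finset.prod_ne_zero_iff.2 fun i _ => (norm_pos_iff.2 (dualVec_ne_zero hx i)).ne'
    positivity
  rw [normGram_factor hx] at hdet ⊢
  refine Matrix.PosDef.conjTranspose_mul_self _ ?_
  rw [Matrix.mulVec_injective_iff_isUnit, Matrix.isUnit_iff_isUnit_det, isUnit_iff_ne_zero]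
  intro h
  rw [Matrix.det_mul, h, mul_zero] at hdet
  exact hdet rfl

/-- The mixed terms of the square are multiples of `∑ ⟪b i, b j⟫`, which vanishes because `∑ b i =
0`. -/
theorem sum_normGram_sub_one_sq :
    ∑ i, ∑ j, (normGram x i j - (1 : Matrix (Fin (n + 1)) (Fin (n + 1)) ℝ) i j) ^ 2
      = (n / invInradius x) ^ 2 * shapeDefect x := by
  have hf := invInradius_pos hx
  have hn : (0 : ℝ) < n := by exact_mod_cast NeZero.pos n
  have hb : ∀ i, ‖dualVec x i‖ ≠ 0 := fun i => (norm_pos_iff.2 (dualVec_ne_zero hx i)).ne'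
  have h1 : ∀ i j, normGram x i j ^ 2 = (n / invInradius x) ^ 2 *
      (inner ℝ (dualVec x i) (dualVec x j) ^ 2 / (‖dualVec x i‖ * ‖dualVec x j‖)
        + 2 / n * inner ℝ (dualVec x i) (dualVec x j)
        + ‖dualVec x i‖ * ‖dualVec x j‖ / n ^ 2) := by
    intro i j
    simp only [normGram, Matrix.of_apply]
    rw [mul_pow, div_pow _ (√‖dualVec x i‖ * √‖dualVec x j‖), mul_pow (√‖dualVec x i‖),
      Real.sq_sqrt (norm_nonneg _), Real.sq_sqrt (norm_nonneg _)]
    have := hb i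
    have := hb j
    field_simp
    ring
  have h2 : ∀ i, ∑ j, inner ℝ (dualVec x i) (dualVec x j) = 0 := fun i => by
    rw [← inner_sum, sum_dualVec hx, inner_zero_right]
  rw [sum_sq_sub_one, trace_normGram hx]
  simp_rw [h1, ← Finset.mul_sum, Finset.sum_add_distrib, ← Finset.mul_sum, h2, ← Finset.sum_div,
    ← Finset.mul_sum, ← Finset.sum_mul]
  rw [← invInradius, shapeDefect]
  simp only [Fintype.card_fin, Nat.cast_add, Nat.cast_one, Finset.sum_const_zero]
  field_simp
  ring

theorem shapeDefect_nonneg : 0 ≤ shapeDefect x := by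
  have hf := invInradius_pos hx
  have hn : (0 : ℝ) < n := by exact_mod_cast NeZero.pos n
  have h := sum_normGram_sub_one_sq hx
  have h0 : (0 : ℝ) ≤ ∑ i, ∑ j, (normGram x i j -
      (1 : Matrix (Fin (n + 1)) (Fin (n + 1)) ℝ) i j) ^ 2 := by positivity
  rw [h] at h0
  exact nonneg_of_mul_nonneg_right h0 (by positivity)

/-- The determinant carries the factor `1 / ∏ ‖b i‖`; the diagonal entries are proportional to `‖b
i‖`, and adding their logarithms cancels it, leaving only `f` and `homDet`. -/
theorem deficit_eq : deficit x =
    -Real.log (normGram x).det - ∑ i, Real.log (normGram x i i) := by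
  have hf := invInradius_pos hx
  have hn : (0 : ℝ) < n := by exact_mod_cast NeZero.pos n
  have hb : ∀ i, 0 < ‖dualVec x i‖ := fun i => norm_pos_iff.2 (dualVec_ne_zero hx i)
  have hP : 0 < ∏ i, ‖dualVec x i‖ := Finset.prod_pos fun i _ => hb i
  have h1 : ∑ i, Real.log (normGram x i i)
      = Real.log (((n + 1) / invInradius x) ^ (n + 1) * ∏ i, ‖dualVec x i‖) := by
    rw [← Real.log_prod]
    · simp only [normGram_diag hx, mul_div_right_comm, Finset.prod_mul_distrib, Finset.prod_const,
        Finset.card_univ, Fintype.card_fin]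
    · intro i _
      rw [normGram_diag hx]
      have := hb i
      positivity
  have hD : 0 < homDet x ^ 2 := by positivity
  rw [h1, det_normGram hx, ← neg_add', ← Real.log_mul (by positivity) (by positivity), deficit,
    ← neg_sub, neg_inj, ← Nat.cast_ofNat (R := ℝ) (n := 2), ← Nat.cast_mul, ← Real.log_pow,
    ← Real.log_div (by positivity) (by positivity)]
  congr 1
  simp only [div_pow, pow_succ, pow_mul]
  field_simp
  ring

/-- The eigenvalues and the diagonal entries are positive with mean `1`, so both sums of logarithms
are nonpositive. -/
theorem deficit_nonneg : 0 ≤ deficit x := by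
  have h1 := log_det_nonpos (posDef_normGram hx) (trace_normGram hx)
  have h2 := sum_log_nonpos (fun i => (posDef_normGram hx).diag_pos (i := i)) (trace_normGram hx)
  rw [deficit_eq hx]
  linarith

/-- The constant is `2 + 2`: one contribution from the eigenvalues and one from the diagonal. -/
theorem deficit_le (h : (n / invInradius x) ^ 2 * shapeDefect x ≤ 1 / 4) :
    deficit x ≤ 4 * ((n / invInradius x) ^ 2 * shapeDefect x) := by
  rw [← sum_normGram_sub_one_sq hx] at h ⊢
  have hle : ∑ i, (normGram x i i - 1) ^ 2 ≤
      ∑ i, ∑ j, (normGram x i j - (1 : Matrix (Fin (n + 1)) (Fin (n + 1)) ℝ) i j) ^ 2 := by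
    refine Finset.sum_le_sum fun i _ => ?_
    refine le_trans (le_of_eq ?_) (Finset.single_le_sum (f := fun j => (normGram x i j -
      (1 : Matrix (Fin (n + 1)) (Fin (n + 1)) ℝ) i j) ^ 2) (fun j _ => sq_nonneg _)
      (Finset.mem_univ i))
    simp
  have h1 := neg_log_det_le (posDef_normGram hx) (trace_normGram hx) h
  have h2 := neg_sum_log_le (trace_normGram hx) (hle.trans h)
  simp only [Matrix.diag] at h2
  rw [deficit_eq hx]
  linarith

/-- Here the normalized Gram matrix is the identity: its diagonal gives equal lengths, its other
entries equal angles. -/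
theorem inner_dualVec_of_shapeDefect_eq_zero (h : shapeDefect x = 0) (i j : Fin (n + 1)) :
    inner ℝ (dualVec x i) (dualVec x j) = (invInradius x / (n + 1)) ^ 2 *
      (if i = j then (1 : ℝ) else -1 / n) := by
  have hf := invInradius_pos hx
  have hn : (0 : ℝ) < n := by exact_mod_cast NeZero.pos n
  have hY : normGram x = 1 := by
    have h1 := sum_normGram_sub_one_sq hx
    rw [h, mul_zero] at h1
    ext i j
    have h2 := (Finset.sum_eq_zero_iff_of_nonneg (fun i _ => Finset.sum_nonneg fun j _ =>
      sq_nonneg _)).1 h1 i (Finset.mem_univ i)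
    have h3 := (Finset.sum_eq_zero_iff_of_nonneg (fun j _ => sq_nonneg _)).1 h2 j (Finset.mem_univ j)
    exact sub_eq_zero.1 (pow_eq_zero_iff two_ne_zero |>.1 h3)
  have hl : ∀ i, ‖dualVec x i‖ = invInradius x / (n + 1) := by
    intro i
    have h1 := normGram_diag hx i
    rw [hY, Matrix.one_apply_eq, eq_div_iff hf.ne'] at h1
    rw [eq_div_iff (by positivity)]
    linarith
  split_ifs with hij
  · rw [hij, real_inner_self_eq_norm_sq, hl, mul_one]
  · have h1 := congrFun (congrFun hY i) j
    rw [Matrix.one_apply_ne hij] at h1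
    simp only [normGram, Matrix.of_apply, hl] at h1
    have hs : √(invInradius x / (n + 1)) ≠ 0 := (Real.sqrt_pos.2 (by positivity)).ne'
    have h2 : inner ℝ (dualVec x i) (dualVec x j)
        + invInradius x / (n + 1) * (invInradius x / (n + 1)) / n = 0 := by
      rcases mul_eq_zero.1 h1 with h | h
      · exact absurd h (by positivity)
      · rcases div_eq_zero_iff.1 h with h | h
        · exact h
        · exact absurd h (mul_ne_zero hs hs)
    rw [eq_neg_of_add_eq_zero_left h2]
    ring

end

end SimplexFlow

end

/-! ### The field controls the shape defect -/

noncomputable section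

namespace SimplexFlow

variable {n : ℕ}

/-- The inertia operator `p ↦ ∑ᵢ ⟪bᵢ, p⟫ bᵢ / ‖bᵢ‖` of the dual vectors. -/
def inertia (x : Config n) (p : EuclideanSpace ℝ (Fin n)) : EuclideanSpace ℝ (Fin n) :=
  ∑ k, (inner ℝ (dualVec x k) p / ‖dualVec x k‖) • dualVec x k

theorem vertex_pullConfig_eq_inertia (x : Config n) (i : Fin (n + 1)) :
    vertex (pullConfig x) i = inertia x (dualVec x i) := rfl

theorem inner_inertia (x : Config n) (p p' : EuclideanSpace ℝ (Fin n)) :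
    inner ℝ (inertia x p) p' =
      ∑ k, inner ℝ (dualVec x k) p * inner ℝ (dualVec x k) p' / ‖dualVec x k‖ := by
  rw [inertia, sum_inner]
  refine Finset.sum_congr rfl fun k _ => ?_
  rw [real_inner_smul_left]
  ring

theorem norm_sq_le_of_matrix (A : Matrix (Fin n) (Fin n) ℝ) (p v : EuclideanSpace ℝ (Fin n))
    (hv : ∀ a, v a = ∑ c, A a c * p c) : ‖v‖ ^ 2 ≤ (∑ a, ∑ c, A a c ^ 2) * ‖p‖ ^ 2 := by
  simp_rw [← real_inner_self_eq_norm_sq, inner_euclidean, ← sq, hv]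
  rw [Finset.sum_mul]
  exact Finset.sum_le_sum fun a _ => Finset.sum_mul_sq_le_sq_mul_sq _ _ _

/-- The matrix of the traceless part of `inertia`. -/
def inertiaMatrix (x : Config n) : Matrix (Fin n) (Fin n) ℝ :=
  Matrix.of fun a c => ∑ k, dualVec x k a * dualVec x k c / ‖dualVec x k‖
    - invInradius x / n * (1 : Matrix (Fin n) (Fin n) ℝ) a c

theorem inertia_sub_smul_apply (x : Config n) (p : EuclideanSpace ℝ (Fin n)) (a : Fin n) :
    (inertia x p - (invInradius x / n) • p) a = ∑ c, inertiaMatrix x a c * p c := by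
  simp only [inertia, inertiaMatrix, Matrix.of_apply, sub_mul, Finset.sum_sub_distrib,
    WithLp.ofLp_sub, WithLp.ofLp_sum, WithLp.ofLp_smul, Pi.sub_apply, Finset.sum_apply,
    Pi.smul_apply, smul_eq_mul, inner_euclidean, Matrix.one_apply, Finset.sum_mul, Finset.sum_div]
  rw [Finset.sum_comm]
  congr 1
  · exact Finset.sum_congr rfl fun _ _ => Finset.sum_congr rfl fun _ _ => by ring
  · simp

section

variable [NeZero n] {x : Config n} (hx : homDet x ≠ 0)

include hx

/-- Since `tr T = f`, the traceless part has squared norm `tr T² - f² / n`, and `tr T²` is the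
double sum in `shapeDefect`. -/
theorem sum_inertiaMatrix_sq : ∑ a, ∑ c, inertiaMatrix x a c ^ 2 = shapeDefect x := by
  have hf := invInradius_pos hx
  have hn : (0 : ℝ) < n := by exact_mod_cast NeZero.pos n
  set N : Matrix (Fin n) (Fin n) ℝ :=
    Matrix.of fun a c => ∑ k, dualVec x k a * dualVec x k c / ‖dualVec x k‖ with hN
  have h1 : ∑ a, ∑ c, N a c ^ 2 = ∑ i, ∑ j,
      inner ℝ (dualVec x i) (dualVec x j) ^ 2 / (‖dualVec x i‖ * ‖dualVec x j‖) := by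
    have e1 : ∀ a c, N a c ^ 2 = ∑ i, ∑ j, dualVec x i a * dualVec x j a *
        (dualVec x i c * dualVec x j c) / (‖dualVec x i‖ * ‖dualVec x j‖) := by
      intro a c
      rw [sq, hN, Matrix.of_apply, Finset.sum_mul_sum]
      exact Finset.sum_congr rfl fun i _ => Finset.sum_congr rfl fun j _ => by ring
    have e2 : ∀ i j, inner ℝ (dualVec x i) (dualVec x j) ^ 2 / (‖dualVec x i‖ * ‖dualVec x j‖)
        = ∑ a, ∑ c, dualVec x i a * dualVec x j a *
        (dualVec x i c * dualVec x j c) / (‖dualVec x i‖ * ‖dualVec x j‖) := by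
      intro i j
      rw [sq, inner_euclidean, Finset.sum_mul_sum, Finset.sum_div]
      exact Finset.sum_congr rfl fun a _ => Finset.sum_div _ _ _
    simp_rw [e1, e2]
    calc _ = ∑ a, ∑ i, ∑ c, ∑ j, dualVec x i a * dualVec x j a *
        (dualVec x i c * dualVec x j c) / (‖dualVec x i‖ * ‖dualVec x j‖) :=
          Finset.sum_congr rfl fun a _ => Finset.sum_comm
      _ = ∑ i, ∑ a, ∑ c, ∑ j, dualVec x i a * dualVec x j a *
        (dualVec x i c * dualVec x j c) / (‖dualVec x i‖ * ‖dualVec x j‖) := Finset.sum_comm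
      _ = ∑ i, ∑ a, ∑ j, ∑ c, dualVec x i a * dualVec x j a *
        (dualVec x i c * dualVec x j c) / (‖dualVec x i‖ * ‖dualVec x j‖) :=
          Finset.sum_congr rfl fun i _ => Finset.sum_congr rfl fun a _ => Finset.sum_comm
      _ = _ := Finset.sum_congr rfl fun i _ => Finset.sum_comm
  have htr : N.trace = invInradius x := by
    simp only [Matrix.trace, Matrix.diag, hN, Matrix.of_apply]
    rw [Finset.sum_comm, invInradius]
    refine Finset.sum_congr rfl fun k _ => ?_
    rw [← Finset.sum_div, ← inner_euclidean, real_inner_self_eq_norm_sq]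
    have := norm_pos_iff.2 (dualVec_ne_zero hx k)
    field_simp
  have hscale : ∀ a c, inertiaMatrix x a c = (invInradius x / n) *
      (((n / invInradius x) • N) a c - (1 : Matrix (Fin n) (Fin n) ℝ) a c) := by
    intro a c
    simp only [inertiaMatrix, Matrix.of_apply, Matrix.smul_apply, smul_eq_mul, hN]
    field_simp
  simp_rw [hscale, mul_pow, ← Finset.mul_sum, sum_sq_sub_one, Matrix.trace_smul, htr,
    Matrix.smul_apply, smul_eq_mul, mul_pow, ← Finset.mul_sum, h1, shapeDefect]
  simp only [Fintype.card_fin]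
  field_simp
  ring

theorem norm_inertia_sub_smul_sq_le (p : EuclideanSpace ℝ (Fin n)) :
    ‖inertia x p - (invInradius x / n) • p‖ ^ 2 ≤ shapeDefect x * ‖p‖ ^ 2 := by
  rw [← sum_inertiaMatrix_sq hx]
  exact norm_sq_le_of_matrix _ _ _ (inertia_sub_smul_apply x p)

-- Because `∑ b i ⊗ x i = 1`, the left side is `tr T²`.
omit [NeZero n] in
theorem sum_inner_inertia_inertia :
    ∑ i, inner ℝ (inertia x (dualVec x i)) (inertia x (vertex x i)) = ∑ i, ∑ j,
      inner ℝ (dualVec x i) (dualVec x j) ^ 2 / (‖dualVec x i‖ * ‖dualVec x j‖) := by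
  have h : ∀ k j, ∑ i, inner ℝ (dualVec x k) (dualVec x i) * inner ℝ (dualVec x j) (vertex x i)
      = inner ℝ (dualVec x j) (dualVec x k) := by
    intro k j
    conv_rhs => rw [← sum_inner_dualVec_smul_vertex hx (dualVec x k), inner_sum]
    refine Finset.sum_congr rfl fun i _ => ?_
    rw [real_inner_smul_right, real_inner_comm]
  have h2 : ∀ i, inner ℝ (inertia x (dualVec x i)) (inertia x (vertex x i)) =
      ∑ k, ∑ j, inner ℝ (dualVec x k) (dualVec x j) / (‖dualVec x k‖ * ‖dualVec x j‖) *
        (inner ℝ (dualVec x k) (dualVec x i) * inner ℝ (dualVec x j) (vertex x i)) := by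
    intro i
    rw [inner_inertia]
    refine Finset.sum_congr rfl fun k _ => ?_
    rw [real_inner_comm (inertia x (vertex x i)), inner_inertia, Finset.mul_sum, Finset.sum_div]
    refine Finset.sum_congr rfl fun j _ => ?_
    rw [real_inner_comm (dualVec x k) (dualVec x j)]
    ring
  simp_rw [h2]
  rw [Finset.sum_comm]
  refine Finset.sum_congr rfl fun k _ => ?_
  rw [Finset.sum_comm]
  refine Finset.sum_congr rfl fun j _ => ?_
  rw [← Finset.mul_sum, h, real_inner_comm (dualVec x k) (dualVec x j)]
  ring

theorem sum_inner_inertia_vertex :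
    ∑ i, inner ℝ (inertia x (dualVec x i)) (vertex x i) = invInradius x := by
  simp_rw [inner_inertia]
  rw [Finset.sum_comm, invInradius]
  refine Finset.sum_congr rfl fun k _ => ?_
  have hk := norm_pos_iff.2 (dualVec_ne_zero hx k)
  have h : ∑ i, inner ℝ (dualVec x k) (dualVec x i) * inner ℝ (dualVec x k) (vertex x i)
      = ‖dualVec x k‖ ^ 2 := by
    rw [← real_inner_self_eq_norm_sq]
    conv_rhs => rw [← sum_inner_dualVec_smul_vertex hx (dualVec x k), inner_sum]
    refine Finset.sum_congr rfl fun i _ => ?_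
    rw [real_inner_smul_right, real_inner_comm, sum_inner_dualVec_smul_vertex hx]
  rw [← Finset.sum_div, h]
  field_simp

omit [NeZero n] in
theorem sum_inner_dualVec_vertex : ∑ i, inner ℝ (dualVec x i) (vertex x i) = n := by
  simp_rw [inner_euclidean]
  rw [Finset.sum_comm]
  simp_rw [sum_dualVec_mul_vertex hx]
  simp

/-- Deform the simplex by the traceless part of `T`. This direction `v` is tangent to the volume
hypersurface, pairs with the pull to `shapeDefect x`, and satisfies `‖v‖² ≤ shapeDefect x * ‖x‖²`;
Cauchy–Schwarz then gives the bound. -/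
theorem shapeDefect_le : shapeDefect x ≤ ‖constrainedPull x‖ ^ 2 * ‖x‖ ^ 2 := by
  have hn : (0 : ℝ) < n := by exact_mod_cast NeZero.pos n
  set v : Config n := ofVertices fun i =>
    inertia x (vertex x i) - (invInradius x / n) • vertex x i with hv
  clear_value v
  have hsymm : ∀ p p', inner ℝ p (inertia x p') = inner ℝ (inertia x p) p' := by
    intro p p'
    rw [real_inner_comm, inner_inertia, inner_inertia]
    exact Finset.sum_congr rfl fun k _ => by ring
  have h1 : inner ℝ (pullConfig x) v = shapeDefect x := by
    simp only [inner_config, hv, vertex_ofVertices, vertex_pullConfig_eq_inertia, inner_sub_right,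
      real_inner_smul_right, Finset.sum_sub_distrib, ← Finset.mul_sum,
      sum_inner_inertia_inertia hx, sum_inner_inertia_vertex hx, shapeDefect]
    ring
  have h2 : inner ℝ (dualConfig x) v = 0 := by
    simp only [inner_config, hv, vertex_ofVertices, vertex_dualConfig, inner_sub_right,
      real_inner_smul_right, Finset.sum_sub_distrib, ← Finset.mul_sum, hsymm,
      sum_inner_inertia_vertex hx, sum_inner_dualVec_vertex hx]
    field_simp
    ring
  have h3 : inner ℝ (constrainedPull x) v = shapeDefect x := by
    rw [constrainedPull, inner_sub_left, real_inner_smul_left, h1, h2]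
    ring
  have h4 : ‖v‖ ^ 2 ≤ shapeDefect x * ‖x‖ ^ 2 := by
    rw [norm_sq_config, norm_sq_config x, Finset.mul_sum]
    refine Finset.sum_le_sum fun i _ => ?_
    have hvi : vertex v i = inertia x (vertex x i) - (invInradius x / n) • vertex x i := by
      rw [hv, vertex_ofVertices]
    rw [hvi]
    exact norm_inertia_sub_smul_sq_le hx _
  rcases (shapeDefect_nonneg hx).eq_or_lt with h0 | h0
  · rw [← h0]; positivity
  · have h5 : shapeDefect x ≤ ‖constrainedPull x‖ * ‖v‖ := h3 ▸ real_inner_le_norm _ _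
    have h6 : shapeDefect x * shapeDefect x
        ≤ shapeDefect x * (‖constrainedPull x‖ ^ 2 * ‖x‖ ^ 2) := by
      calc shapeDefect x * shapeDefect x ≤ (‖constrainedPull x‖ * ‖v‖) * (‖constrainedPull x‖ * ‖v‖) :=
            mul_self_le_mul_self h0.le h5
        _ = ‖constrainedPull x‖ ^ 2 * ‖v‖ ^ 2 := by ring
        _ ≤ ‖constrainedPull x‖ ^ 2 * (shapeDefect x * ‖x‖ ^ 2) := by gcongr
        _ = _ := by ring
    exact le_of_mul_le_mul_left h6 h0

/-- Zero defect means that `T` is the scalar `f / n`, so the pull is parallel to the volume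
gradient. -/
theorem constrainedPull_eq_zero_iff : constrainedPull x = 0 ↔ shapeDefect x = 0 := by
  constructor
  · intro h
    refine le_antisymm ?_ (shapeDefect_nonneg hx)
    simpa [h] using shapeDefect_le hx
  · intro h
    have h1 : pullConfig x = (invInradius x / n) • dualConfig x := by
      refine config_ext fun i => ?_
      have h2 := norm_inertia_sub_smul_sq_le hx (dualVec x i)
      rw [h, zero_mul] at h2
      have h3 := pow_eq_zero_iff two_ne_zero |>.1 (le_antisymm h2 (sq_nonneg _))
      exact sub_eq_zero.1 (norm_eq_zero.1 h3)
    have hb : ‖dualConfig x‖ ≠ 0 := norm_ne_zero_iff.2 (dualConfig_ne_zero hx)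
    rw [constrainedPull, h1, real_inner_smul_right, real_inner_self_eq_norm_sq,
      mul_div_cancel_right₀ _ (pow_ne_zero 2 hb), sub_self]

end

end SimplexFlow

end

/-! ### Critical simplices are the regular ones -/

noncomputable section

namespace SimplexFlow

variable {n : ℕ}

theorem eq_of_inner_dualVec {x : Config n} (hx : homDet x ≠ 0) {p p' : EuclideanSpace ℝ (Fin n)}
    (h : ∀ j, inner ℝ (dualVec x j) p = inner ℝ (dualVec x j) p') : p = p' := by
  rw [← sum_inner_dualVec_smul_vertex hx p, ← sum_inner_dualVec_smul_vertex hx p']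
  simp_rw [h]

section regular

variable [NeZero n] {x : Config n} (hx : homDet x ≠ 0)

include hx

theorem vertex_sub_of_shapeDefect_eq_zero (h : shapeDefect x = 0) (i k : Fin (n + 1)) :
    vertex x i - vertex x k = (n * (n + 1) / invInradius x ^ 2) • (dualVec x i - dualVec x k) := by
  have hf := invInradius_pos hx
  have hn : (0 : ℝ) < n := by exact_mod_cast NeZero.pos n
  refine eq_of_inner_dualVec hx fun j => ?_
  rw [inner_dualVec_vertex_sub hx, real_inner_smul_right, inner_sub_right,
    inner_dualVec_of_shapeDefect_eq_zero hx h, inner_dualVec_of_shapeDefect_eq_zero hx h]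
  simp only [eq_comm (a := i), eq_comm (a := k)]
  split_ifs <;> field_simp <;> ring

/-- The vertices are `κ • b i` up to a common translation. The linear map sending `κ • b i` to `κ •
b (e i)` preserves norms, since the Gram matrix of the `b i` is invariant under permutations. -/
theorem exists_isometryEquiv_of_shapeDefect_eq_zero (h : shapeDefect x = 0)
    (e : Equiv.Perm (Fin (n + 1))) :
    ∃ T : EuclideanSpace ℝ (Fin n) ≃ᵢ EuclideanSpace ℝ (Fin n), vertex x ∘ e = T ∘ vertex x := by
  set κ : ℝ := n * (n + 1) / invInradius x ^ 2 with hκ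
  have hsub := vertex_sub_of_shapeDefect_eq_zero hx h
  have hsum : ∀ p : EuclideanSpace ℝ (Fin n), ∑ i, inner ℝ (dualVec x i) p = 0 := fun p => by
    rw [← sum_inner, sum_dualVec hx, inner_zero_left]
  let A : EuclideanSpace ℝ (Fin n) →ₗ[ℝ] EuclideanSpace ℝ (Fin n) :=
    { toFun := fun p => ∑ i, inner ℝ (dualVec x i) p • (κ • dualVec x (e i))
      map_add' := fun p p' => by simp [inner_add_right, add_smul, Finset.sum_add_distrib]
      map_smul' := fun c p => by
        simp [inner_smul_right, mul_smul, Finset.smul_sum] }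
  have hA : ∀ p, A p = ∑ i, inner ℝ (dualVec x i) p • (κ • dualVec x (e i)) := fun _ => rfl
  have hid : ∀ p, ∑ i, inner ℝ (dualVec x i) p • (κ • dualVec x i) = p := by
    intro p
    have : ∀ i, κ • dualVec x i = vertex x i - (vertex x 0 - κ • dualVec x 0) := fun i => by
      rw [sub_sub_eq_add_sub, add_comm, add_sub_assoc, hsub i 0, ← hκ, ← smul_add]
      congr 1
      abel
    calc ∑ i, inner ℝ (dualVec x i) p • (κ • dualVec x i)
        = ∑ i, (inner ℝ (dualVec x i) p • vertex x i
          - inner ℝ (dualVec x i) p • (vertex x 0 - κ • dualVec x 0)) :=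
          Finset.sum_congr rfl fun i _ => by rw [this, smul_sub]
      _ = p := by
          rw [Finset.sum_sub_distrib, ← Finset.sum_smul, hsum,
            sum_inner_dualVec_smul_vertex hx, zero_smul, sub_zero]
  have hnorm : ∀ p, ‖A p‖ = ‖p‖ := by
    intro p
    rw [← sq_eq_sq₀ (norm_nonneg _) (norm_nonneg _), ← real_inner_self_eq_norm_sq,
      ← real_inner_self_eq_norm_sq]
    conv_rhs => rw [← hid p]
    rw [hA]
    simp_rw [sum_inner, inner_sum, real_inner_smul_left, real_inner_smul_right,
      inner_dualVec_of_shapeDefect_eq_zero hx h, e.injective.eq_iff]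
  let A' : EuclideanSpace ℝ (Fin n) ≃ₗᵢ[ℝ] EuclideanSpace ℝ (Fin n) :=
    LinearIsometry.toLinearIsometryEquiv ⟨A, hnorm⟩ rfl
  refine ⟨((IsometryEquiv.subRight (vertex x 0)).trans A'.toIsometryEquiv).trans
    (IsometryEquiv.addLeft (vertex x (e 0))), funext fun i => ?_⟩
  change vertex x (e i) = vertex x (e 0) + A (vertex x i - vertex x 0)
  have : A (vertex x i - vertex x 0) = vertex x (e i) - vertex x (e 0) := by
    rw [hsub (e i), ← hκ, hA]
    simp_rw [inner_dualVec_vertex_sub hx, sub_smul, Finset.sum_sub_distrib]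
    simp [smul_sub]
  rw [this]
  abel

/-- Polarization gives all inner products of edges, hence `b i` as a multiple of `∑ (x i - x m)`;
the defect is then computed from the resulting Gram matrix. -/
theorem shapeDefect_eq_zero_of_equilateral {d : ℝ} (hd : ∀ i j, i ≠ j →
    dist (vertex x i) (vertex x j) = d) : shapeDefect x = 0 := by
  have hf := invInradius_pos hx
  have hn : (0 : ℝ) < n := by exact_mod_cast NeZero.pos n
  have hsq : ∀ i j, ‖vertex x i - vertex x j‖ ^ 2 = d ^ 2 - if i = j then d ^ 2 else 0 := by
    intro i j
    split_ifs with h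
    · simp [h]
    · rw [← dist_eq_norm, hd i j h, sub_zero]
  have hd0 : d ≠ 0 := by
    rintro rfl
    have : Nontrivial (Fin (n + 1)) :=
      Fin.nontrivial_iff_two_le.2 (by have := NeZero.pos n; omega)
    obtain ⟨k, hk⟩ := exists_ne (0 : Fin (n + 1))
    have h1 := inner_dualVec_vertex_sub hx 0 0 k
    rw [dist_eq_zero.1 (hd 0 k hk.symm)] at h1
    simp [hk] at h1
  have hin : ∀ i k m, inner ℝ (vertex x i - vertex x m) (vertex x k - vertex x i)
      = -(1 / 2) * (d ^ 2 - (if i = m then d ^ 2 else 0) - (if k = i then d ^ 2 else 0)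
        + (if k = m then d ^ 2 else 0)) := by
    intro i k m
    have h1 := norm_add_sq_real (vertex x i - vertex x m) (vertex x k - vertex x i)
    rw [add_comm, sub_add_sub_cancel, hsq, hsq, hsq] at h1
    linarith
  have hb : ∀ i, (2 / ((n + 1) * d ^ 2)) • ∑ m, (vertex x i - vertex x m) = dualVec x i := by
    intro i
    refine eq_dualVec_of_inner_vertex_sub hx fun k => ?_
    rw [real_inner_smul_left, sum_inner]
    simp_rw [hin, ← Finset.mul_sum, Finset.sum_add_distrib, Finset.sum_sub_distrib]
    simp only [Finset.sum_const, Finset.card_univ, Fintype.card_fin, Finset.sum_ite_eq,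
      Finset.mem_univ, if_true, nsmul_eq_mul, Nat.cast_add, Nat.cast_one]
    split_ifs <;> field_simp <;> ring
  have hsub : ∀ i k, dualVec x i - dualVec x k = (2 / d ^ 2) • (vertex x i - vertex x k) := by
    intro i k
    rw [← hb, ← hb, ← smul_sub, ← Finset.sum_sub_distrib]
    simp only [sub_sub_sub_cancel_right, Finset.sum_const, Finset.card_univ, Fintype.card_fin]
    rw [← Nat.cast_smul_eq_nsmul ℝ, smul_smul]
    congr 1
    push_cast
    field_simp
  -- Differences of these inner products are known; summing over the second index and using `∑ b k =
  -- 0` fixes the remaining constant.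
  have hP : ∀ i j, inner ℝ (dualVec x i) (dualVec x j)
      = 2 / d ^ 2 * ((if i = j then 1 else 0) - 1 / (n + 1)) := by
    intro i j
    have h1 : ∀ k, inner ℝ (dualVec x i) (dualVec x j) - inner ℝ (dualVec x i) (dualVec x k)
        = 2 / d ^ 2 * ((if j = i then 1 else 0) - (if k = i then 1 else 0)) := by
      intro k
      rw [← inner_sub_right, hsub, real_inner_smul_right, inner_dualVec_vertex_sub hx]
    have h2 := Finset.sum_congr rfl fun k (_ : k ∈ Finset.univ) => h1 k
    rw [Finset.sum_sub_distrib, ← inner_sum _ (fun k => dualVec x k) (dualVec x i),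
      sum_dualVec hx, inner_zero_right, ← Finset.mul_sum, Finset.sum_sub_distrib] at h2
    simp only [Finset.sum_const, Finset.card_univ, Fintype.card_fin, Finset.sum_ite_eq',
      Finset.mem_univ, if_true, nsmul_eq_mul, Nat.cast_add, Nat.cast_one, sub_zero] at h2
    rw [← mul_left_cancel_iff_of_pos (by positivity : (0 : ℝ) < n + 1), h2]
    simp only [eq_comm (a := j)]
    field_simp
  set s : ℝ := 2 / d ^ 2 * (1 - 1 / (n + 1)) with hs
  have hl2 : ∀ i, ‖dualVec x i‖ ^ 2 = s := fun i => by
    rw [← real_inner_self_eq_norm_sq, hP, if_pos rfl]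
  have hl : ∀ i, ‖dualVec x i‖ = √s := fun i => by
    rw [← hl2 i, Real.sqrt_sq (norm_nonneg _)]
  have hspos : 0 < s := by
    rw [← hl2 0]
    exact pow_pos (norm_pos_iff.2 (dualVec_ne_zero hx 0)) 2
  have hrow : ∀ i, ∑ j, inner ℝ (dualVec x i) (dualVec x j) ^ 2 / (‖dualVec x i‖ * ‖dualVec x j‖)
      = (2 / d ^ 2) ^ 2 * (1 - 1 / (n + 1)) / s := by
    intro i
    simp_rw [hl, Real.mul_self_sqrt hspos.le, ← Finset.sum_div, hP, mul_pow, ← Finset.mul_sum]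
    congr 2
    have : ∀ j, ((if i = j then (1 : ℝ) else 0) - 1 / (n + 1)) ^ 2
        = (if i = j then 1 - 2 / ((n : ℝ) + 1) else 0) + 1 / (n + 1) ^ 2 := by
      intro j
      split_ifs <;> field_simp <;> ring
    simp_rw [this, Finset.sum_add_distrib]
    simp
    field_simp
    ring
  rw [shapeDefect, invInradius]
  simp_rw [hrow, hl]
  simp only [Finset.sum_const, Finset.card_univ, Fintype.card_fin, nsmul_eq_mul, Nat.cast_add,
    Nat.cast_one, mul_pow, Real.sq_sqrt hspos.le]
  rw [hs]
  have : (1 : ℝ) - 1 / (n + 1) = n / (n + 1) := by field_simp; ring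
  rw [this]
  field_simp
  ring

end regular

theorem LabeledSimplex.homDet_ne_zero (x : LabeledSimplex n) : homDet x.1 ≠ 0 :=
  (affineIndependent_iff_homDet_ne_zero x.1).1 x.2

theorem LabeledSimplex.isRegular_iff [NeZero n] (x : LabeledSimplex n) :
    x.IsRegular ↔ shapeDefect x.1 = 0 := by
  constructor
  · intro h
    obtain ⟨d, hd⟩ := Affine.Simplex.Regular.equilateral h
    exact shapeDefect_eq_zero_of_equilateral x.homDet_ne_zero hd
  · intro h e
    exact exists_isometryEquiv_of_shapeDefect_eq_zero x.homDet_ne_zero h e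

/-! ### Equivariance under isometries and relabelings -/

section equivariance

variable {x y : Config n} {A : EuclideanSpace ℝ (Fin n) ≃ₗᵢ[ℝ] EuclideanSpace ℝ (Fin n)}
  {c : EuclideanSpace ℝ (Fin n)} {e : Equiv.Perm (Fin (n + 1))}
  (h : ∀ i, vertex y i = A (vertex x (e i)) + c) (hx : homDet x ≠ 0) (hy : homDet y ≠ 0)

include h hx hy

theorem dualVec_of_isometry (i : Fin (n + 1)) : dualVec y i = A (dualVec x (e i)) := by
  refine (eq_dualVec_of_inner_vertex_sub hy fun k => ?_).symm
  rw [h, h, add_sub_add_right_eq_sub, ← map_sub, LinearIsometryEquiv.inner_map_map,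
    inner_dualVec_vertex_sub hx]
  simp

theorem invInradius_of_isometry : invInradius y = invInradius x := by
  simp_rw [invInradius, dualVec_of_isometry h hx hy, LinearIsometryEquiv.norm_map]
  exact Equiv.sum_comp e fun i => ‖dualVec x i‖

theorem pullConfig_of_isometry (i : Fin (n + 1)) :
    vertex (pullConfig y) i = A (vertex (pullConfig x) (e i)) := by
  simp_rw [vertex_pullConfig, dualVec_of_isometry h hx hy, LinearIsometryEquiv.norm_map,
    LinearIsometryEquiv.inner_map_map, map_sum, map_smul]
  exact Equiv.sum_comp e fun j =>
    (inner ℝ (dualVec x j) (dualVec x (e i)) / ‖dualVec x j‖) • A (dualVec x j)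

theorem constrainedPull_of_isometry (i : Fin (n + 1)) :
    vertex (constrainedPull y) i = A (vertex (constrainedPull x) (e i)) := by
  have h1 : inner ℝ (dualConfig y) (pullConfig y) = inner ℝ (dualConfig x) (pullConfig x) := by
    simp_rw [inner_config, pullConfig_of_isometry h hx hy, vertex_dualConfig,
      dualVec_of_isometry h hx hy, LinearIsometryEquiv.inner_map_map]
    exact Equiv.sum_comp e fun i => inner ℝ (dualVec x i) (vertex (pullConfig x) i)
  have h2 : ‖dualConfig y‖ ^ 2 = ‖dualConfig x‖ ^ 2 := by
    simp_rw [norm_sq_config, vertex_dualConfig, dualVec_of_isometry h hx hy,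
      LinearIsometryEquiv.norm_map]
    exact Equiv.sum_comp e fun i => ‖dualVec x i‖ ^ 2
  rw [constrainedPull, constrainedPull, h1, h2]
  simp only [vertex_sub, vertex_smul, vertex_dualConfig, dualVec_of_isometry h hx hy,
    pullConfig_of_isometry h hx hy, map_sub, map_smul]

theorem inflationField_of_isometry [NeZero n] {g : ℝ → ℝ} (hg : ContDiffOn ℝ ∞ g (Ioi 0))
    (i : Fin (n + 1)) :
    vertex (inflationField g y) i = A (vertex (inflationField g x) (e i)) := by
  rw [inflationField_eq hg hx, inflationField_eq hg hy, inradius_eq_inv hx, inradius_eq_inv hy,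
    invInradius_of_isometry h hx hy]
  simp only [vertex_smul, constrainedPull_of_isometry h hx hy, map_smul]

end equivariance

end SimplexFlow

end

/-! ### Lyapunov estimates on a half-line -/

noncomputable section

namespace SimplexFlow

section halfLine

variable {E : Type*} [NormedAddCommGroup E] [NormedSpace ℝ E]

theorem continuousOn_Ici_of_hasDerivWithinAt {f f' : ℝ → E}
    (h : ∀ t, 0 ≤ t → HasDerivWithinAt f (f' t) (Ici 0) t) : ContinuousOn f (Ici 0) :=
  fun t ht => (h t ht).continuousWithinAt

theorem deriv_eq_of_hasDerivWithinAt_Ici {f f' : ℝ → E}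
    (h : ∀ t, 0 ≤ t → HasDerivWithinAt f (f' t) (Ici 0) t) {t : ℝ} (ht : 0 < t) :
    deriv f t = f' t :=
  ((h t ht.le).hasDerivAt (Ici_mem_nhds ht)).deriv

theorem monotoneOn_Ici_of_hasDerivWithinAt {f f' : ℝ → ℝ}
    (h : ∀ t, 0 ≤ t → HasDerivWithinAt f (f' t) (Ici 0) t) (h' : ∀ t, 0 ≤ t → 0 ≤ f' t) :
    MonotoneOn f (Ici 0) := by
  refine monotoneOn_of_deriv_nonneg (convex_Ici 0) (continuousOn_Ici_of_hasDerivWithinAt h) ?_ ?_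
  · rw [interior_Ici]
    exact fun t ht =>
      ((h t (le_of_lt ht)).hasDerivAt (Ici_mem_nhds ht)).differentiableAt.differentiableWithinAt
  · rw [interior_Ici]
    intro t ht
    rw [deriv_eq_of_hasDerivWithinAt_Ici h ht]
    exact h' t (le_of_lt ht)

theorem strictMonoOn_Ici_of_hasDerivWithinAt {f f' : ℝ → ℝ}
    (h : ∀ t, 0 ≤ t → HasDerivWithinAt f (f' t) (Ici 0) t) (h' : ∀ t, 0 ≤ t → 0 < f' t) :
    StrictMonoOn f (Ici 0) := by
  refine strictMonoOn_of_deriv_pos (convex_Ici 0) (continuousOn_Ici_of_hasDerivWithinAt h) ?_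
  rw [interior_Ici]
  intro t ht
  rw [deriv_eq_of_hasDerivWithinAt_Ici h ht]
  exact h' t (le_of_lt ht)

theorem eq_of_hasDerivWithinAt_Ici_zero {f : ℝ → E}
    (h : ∀ t, 0 ≤ t → HasDerivWithinAt f 0 (Ici 0) t) {t : ℝ} (ht : 0 ≤ t) : f t = f 0 := by
  refine constant_of_has_deriv_right_zero
    ((continuousOn_Ici_of_hasDerivWithinAt h).mono Icc_subset_Ici_self)
    (fun s hs => (h s hs.1).mono (Ici_subset_Ici.2 hs.1)) t ⟨ht, le_rfl⟩

/-- The decay of a Lyapunov function along a curve, under a Łojasiewicz inequality. -/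
theorem lyapunov_le_exp {Λ w : ℝ → ℝ} {a : ℝ}
    (hΛ : ∀ t, 0 ≤ t → HasDerivWithinAt Λ (-w t) (Ici 0) t) (hw : ∀ t, 0 ≤ t → a * Λ t ≤ w t)
    {t : ℝ} (ht : 0 ≤ t) : Λ t ≤ Λ 0 * Real.exp (-a * t) := by
  have h1 : ∀ t, 0 ≤ t → HasDerivWithinAt (fun t => -(Λ t * Real.exp (a * t)))
      (-(-w t * Real.exp (a * t) + Λ t * (Real.exp (a * t) * (a * 1)))) (Ici 0) t := fun t ht =>
    ((hΛ t ht).mul (((hasDerivAt_id' t).const_mul a).exp.hasDerivWithinAt)).neg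
  have h2 := monotoneOn_Ici_of_hasDerivWithinAt h1 (fun t ht => by
    have := mul_le_mul_of_nonneg_right (hw t ht) (Real.exp_pos (a * t)).le
    nlinarith) self_mem_Ici ht ht
  simp only [mul_zero, Real.exp_zero, mul_one, neg_le_neg_iff] at h2
  rw [neg_mul, Real.exp_neg, ← div_eq_mul_inv, le_div_iff₀ (Real.exp_pos _)]
  exact h2

/-- The length estimate for a curve along which a Lyapunov function satisfies a Łojasiewicz
inequality. -/
theorem norm_sub_le_of_lyapunov {γ v : ℝ → E} {Λ w : ℝ → ℝ} {c C : ℝ} (hc : 0 < c)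
    (hγ : ∀ t, 0 ≤ t → HasDerivWithinAt γ (v t) (Ici 0) t)
    (hΛ : ∀ t, 0 ≤ t → HasDerivWithinAt Λ (-w t) (Ici 0) t) (hpos : ∀ t, 0 ≤ t → 0 < Λ t)
    (hw : ∀ t, 0 ≤ t → c * ‖v t‖ ^ 2 ≤ w t) (hC : ∀ t, 0 ≤ t → Λ t ≤ C * ‖v t‖ ^ 2)
    {s t : ℝ} (hs : 0 ≤ s) (hst : s ≤ t) : ‖γ t - γ s‖ ≤ 2 * √C / c * √(Λ s) := by
  -- The function `√Λ` decreases at rate `w / (2 √Λ) ≥ c ‖v‖ / (2 √C)`, so this multiple of its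
  -- decrease dominates arc length. Positivity of `Λ` is needed to differentiate the root.
  have hB : ∀ u, 0 ≤ u → HasDerivWithinAt (fun u => 2 * √C / c * (√(Λ s) - √(Λ u)))
      (2 * √C / c * -(-w u / (2 * √(Λ u)))) (Ici 0) u := fun u hu =>
    (((hΛ u hu).sqrt (hpos u hu).ne').const_sub _).const_mul _
  have h := image_norm_le_of_norm_deriv_right_le_deriv_boundary' (f := fun u => γ u - γ s)
    (f' := v) (a := s) (b := t)
    (((continuousOn_Ici_of_hasDerivWithinAt hγ).mono
      (Icc_subset_Ici_self.trans (Ici_subset_Ici.2 hs))).sub continuousOn_const)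
    (fun u hu => (((hγ u (hs.trans hu.1)).mono (Ici_subset_Ici.2 (hs.trans hu.1))).sub_const _))
    (B := fun u => 2 * √C / c * (√(Λ s) - √(Λ u)))
    (B' := fun u => 2 * √C / c * -(-w u / (2 * √(Λ u)))) (by simp)
    ((continuousOn_Ici_of_hasDerivWithinAt hB).mono
      (Icc_subset_Ici_self.trans (Ici_subset_Ici.2 hs)))
    (fun u hu => ((hB u (hs.trans hu.1)).mono (Ici_subset_Ici.2 (hs.trans hu.1))))
    (fun u hu => ?_) ⟨hst, le_rfl⟩
  · refine h.trans ?_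
    have : 0 ≤ √(Λ t) := Real.sqrt_nonneg _
    have : 0 ≤ 2 * √C / c := by positivity
    gcongr
    linarith
  · have hu0 := hs.trans hu.1
    have h1 : 0 < √(Λ u) := Real.sqrt_pos.2 (hpos u hu0)
    have h2 : √(Λ u) ≤ √C * ‖v u‖ := by
      refine (Real.sqrt_le_sqrt (hC u hu0)).trans_eq ?_
      rw [Real.sqrt_mul' _ (sq_nonneg _), Real.sqrt_sq (norm_nonneg _)]
    have h3 := hw u hu0
    have h4 : 2 * √C / c * -(-w u / (2 * √(Λ u))) = √C * w u / (c * √(Λ u)) := by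
      field_simp
    rw [h4, le_div_iff₀ (by positivity)]
    calc ‖v u‖ * (c * √(Λ u)) ≤ ‖v u‖ * (c * (√C * ‖v u‖)) := by gcongr
      _ = √C * (c * ‖v u‖ ^ 2) := by ring
      _ ≤ √C * w u := by gcongr

end halfLine

/-! ### Global solutions and compact trapping sets -/

section globalFlow

variable {E : Type*} [NormedAddCommGroup E] [NormedSpace ℝ E] [CompleteSpace E]

/-- A bounded field cannot leave the ball of radius `M * (N + 1)` in time `N + 1`, so
Picard–Lindelöf applies on every symmetric interval; uniqueness glues the solutions. -/
theorem exists_global_solution {v : E → E} {K : ℝ≥0} (hK : LipschitzWith K v) {M : ℝ≥0}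
    (hM : ∀ x, ‖v x‖ ≤ M) (x : E) :
    ∃ γ : ℝ → E, γ 0 = x ∧ ∀ t, HasDerivAt γ (v (γ t)) t := by
  have hloc : ∀ N : ℕ, ∃ α : ℝ → E, α 0 = x ∧
      ∀ t ∈ Ioo (-(N + 1 : ℝ)) (N + 1), HasDerivAt α (v (α t)) t := by
    intro N
    have hN : (0 : ℝ) ≤ N + 1 := by positivity
    have hPL : IsPicardLindelof (fun _ => v) (tmin := -(N + 1 : ℝ)) (tmax := N + 1)
        ⟨0, by constructor <;> linarith⟩ x (M * (N + 1)) 0 M K :=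
      { lipschitzOnWith := fun _ _ => hK.lipschitzOnWith
        continuousOn := fun _ _ => continuousOn_const
        norm_le := fun _ _ y _ => hM y
        mul_max_le := by simp }
    obtain ⟨α, h0, h1⟩ := hPL.exists_eq_forall_mem_Icc_hasDerivWithinAt₀
    exact ⟨α, h0, fun t ht => (h1 t (Ioo_subset_Icc_self ht)).hasDerivAt
      (Icc_mem_nhds ht.1 ht.2)⟩
  choose α h0 h1 using hloc
  have heq : ∀ N L : ℕ, N ≤ L → ∀ s ∈ Ioo (-(N + 1 : ℝ)) (N + 1), α N s = α L s := by
    intro N L hNL s hs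
    have hNL' : (N : ℝ) ≤ L := by exact_mod_cast hNL
    have hN : (0 : ℝ) ≤ N := N.cast_nonneg
    refine ODE_solution_unique_of_mem_Ioo (v := fun _ => v) (s := fun _ => univ) (K := K) (t₀ := 0)
      (fun _ _ => hK.lipschitzOnWith) ⟨by linarith, by linarith⟩
      (fun t ht => ⟨h1 N t ht, trivial⟩)
      (fun t ht => ⟨h1 L t ⟨by linarith [ht.1], by linarith [ht.2]⟩, trivial⟩) ?_ hs
    rw [h0, h0]
  have hmem : ∀ s : ℝ, s ∈ Ioo (-((⌈|s|⌉₊ : ℕ) + 1 : ℝ)) ((⌈|s|⌉₊ : ℕ) + 1) := by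
    intro s
    have := Nat.le_ceil |s|
    exact abs_lt.1 (by linarith)
  refine ⟨fun t => α ⌈|t|⌉₊ t, by simp [h0], fun t => ?_⟩
  refine (h1 _ t (hmem t)).congr_of_eventuallyEq ?_
  filter_upwards [Ioo_mem_nhds (hmem t).1 (hmem t).2] with s hs
  rcases le_total ⌈|s|⌉₊ ⌈|t|⌉₊ with h | h
  · exact heq _ _ h s (hmem s)
  · exact (heq _ _ h s hs).symm

omit [CompleteSpace E] in
theorem eq_const_of_solution {v : E → E} {K : ℝ≥0} (hK : LipschitzWith K v) {γ : ℝ → E}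
    (hγ : ∀ t, HasDerivAt γ (v (γ t)) t) {t : ℝ} (ht : v (γ t) = 0) (s : ℝ) : γ s = γ t := by
  have := ODE_solution_unique_univ (v := fun _ => v) (s := fun _ => univ) (K := K) (t₀ := t)
    (f := γ) (g := fun _ => γ t) (fun _ => hK.lipschitzOnWith) (fun t => ⟨hγ t, trivial⟩)
    (fun u => ⟨by rw [ht]; exact hasDerivAt_const u _, trivial⟩) rfl
  exact congrFun this s

end globalFlow

section trapping

variable {E : Type*} [NormedAddCommGroup E] [NormedSpace ℝ E] [FiniteDimensional ℝ E]

/-- A compactly supported `C¹` field is globally Lipschitz and bounded, so the cut-off field has a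
complete flow. -/
theorem exists_cutoff {F : E → E} {X S : Set E} (hX : IsOpen X) (hF : ∀ x ∈ X, ContDiffAt ℝ 1 F x)
    (hS : IsCompact S) (hSX : S ⊆ X) :
    ∃ χ : E → ℝ, (∀ x, 0 ≤ χ x) ∧ (∀ x ∈ S, χ x = 1) ∧ (∀ x ∉ X, χ x = 0) ∧
      (∃ K : ℝ≥0, LipschitzWith K fun x => χ x • F x) ∧ ∃ M : ℝ≥0, ∀ x, ‖χ x • F x‖ ≤ M := by
  obtain ⟨L, hL, hSL, hLX⟩ := exists_compact_between hS hX hSX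
  obtain ⟨χ, hχ, hrange, hsupp, hone⟩ := exists_contMDiff_support_eq_eq_one_iff (n := 1)
    (modelWithCornersSelf ℝ E) (isOpen_interior (s := L)) hS.isClosed hSL
  have hts : tsupport χ ⊆ L := by
    rw [tsupport, hsupp]
    exact closure_minimal interior_subset hL.isClosed
  have hcs : HasCompactSupport χ := hL.of_isClosed_subset (isClosed_tsupport _) hts
  have hdiff : ContDiff ℝ 1 fun x => χ x • F x := by
    rw [contDiff_iff_contDiffAt]
    intro x
    by_cases hx : x ∈ X
    · exact (contMDiff_iff_contDiff.1 hχ).contDiffAt.smul (hF x hx)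
    · have h0 : χ =ᶠ[𝓝 x] 0 := notMem_tsupport_iff_eventuallyEq.1 fun h => hx (hLX (hts h))
      refine (contDiffAt_const (c := (0 : E))).congr_of_eventuallyEq ?_
      filter_upwards [h0] with y hy
      simp [hy]
  have hcs' : HasCompactSupport fun x => χ x • F x := hcs.smul_right
  refine ⟨χ, fun x => (hrange ⟨x, rfl⟩).1, fun x hx => (hone x).1 hx, fun x hx => ?_,
    hdiff.lipschitzWith_of_hasCompactSupport hcs' (by simp), ?_⟩
  · by_contra h
    have : x ∈ interior L := hsupp ▸ h
    exact hx (hLX (interior_subset this))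
  · obtain ⟨M, hM⟩ := hcs'.exists_bound_of_continuous hdiff.continuous
    exact ⟨M.toNNReal, fun x => (hM x).trans (Real.le_coe_toNNReal M)⟩

/-- A trapping set of a vector field: reparametrized integral curves in `X` that start in `S` stay
in `S`. -/
def IsTrapping (F : E → E) (X S : Set E) : Prop :=
  ∀ (γ : ℝ → E) (c : ℝ → ℝ), (∀ t, 0 ≤ t → γ t ∈ X) → (∀ t, 0 ≤ t → 0 ≤ c t) →
    (∀ t, 0 ≤ t → HasDerivWithinAt γ (c t • F (γ t)) (Ici 0) t) → γ 0 ∈ S → ∀ t, 0 ≤ t → γ t ∈ S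

/-- An integral curve in `X`, on the half-line of nonnegative times. -/
structure IsForwardCurve (F : E → E) (X : Set E) (γ : ℝ → E) : Prop where
  mem : ∀ t, 0 ≤ t → γ t ∈ X
  deriv : ∀ t, 0 ≤ t → HasDerivWithinAt γ (F (γ t)) (Ici 0) t

omit [FiniteDimensional ℝ E] in
theorem IsForwardCurve.mem_of_isTrapping {F : E → E} {X S : Set E} {γ : ℝ → E}
    (hγ : IsForwardCurve F X γ) (hS : IsTrapping F X S) (h0 : γ 0 ∈ S) {t : ℝ} (ht : 0 ≤ t) :
    γ t ∈ S :=
  hS γ (fun _ => 1) hγ.mem (fun _ _ => zero_le_one)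
    (fun t ht => by simpa using hγ.deriv t ht) h0 t ht

/-- Existence, continuous dependence and backward uniqueness of integral curves that start in a
compact trapping set. -/
theorem exists_flow_of_isTrapping {F : E → E} {X S : Set E} (hX : IsOpen X)
    (hF : ∀ x ∈ X, ContDiffAt ℝ 1 F x) (hS : IsCompact S) (hSX : S ⊆ X) (htrap : IsTrapping F X S) :
    (∀ x ∈ S, ∃ γ : ℝ → E, γ 0 = x ∧ IsForwardCurve F X γ) ∧
    (∃ K : ℝ≥0, ∀ γ γ' : ℝ → E, IsForwardCurve F X γ → IsForwardCurve F X γ' → γ 0 ∈ S → γ' 0 ∈ S →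
      ∀ t, 0 ≤ t → dist (γ t) (γ' t) ≤ dist (γ 0) (γ' 0) * Real.exp (K * t)) ∧
    (∀ γ : ℝ → E, IsForwardCurve F X γ → γ 0 ∈ S → ∀ t, 0 ≤ t → F (γ t) = 0 → F (γ 0) = 0) := by
  obtain ⟨χ, hχ0, hχ1, hχX, ⟨K, hK⟩, M, hM⟩ := exists_cutoff hX hF hS hSX
  have hex : ∀ x ∈ S, ∃ γ : ℝ → E, γ 0 = x ∧ IsForwardCurve F X γ ∧
      ∀ t, HasDerivAt γ (χ (γ t) • F (γ t)) t := by
    intro x hx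
    obtain ⟨γ, h0, hγ⟩ := exists_global_solution hK hM x
    -- The cut-off field vanishes off `X`, so a solution that meets the complement is constant there
    -- and could not start in `S`.
    have hmem : ∀ t, γ t ∈ X := by
      intro t
      by_contra ht
      have h1 := eq_const_of_solution hK hγ (t := t) (by simp [hχX _ ht]) 0
      rw [h0] at h1
      exact ht (h1 ▸ hSX hx)
    -- A solution of the cut-off field is a curve of `F` with speed factor `χ`; this is why trapping
    -- is required for reparametrized curves.
    have hS' : ∀ t, 0 ≤ t → γ t ∈ S := htrap γ (fun t => χ (γ t)) (fun t _ => hmem t)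
      (fun t _ => hχ0 _) (fun t _ => (hγ t).hasDerivWithinAt) (h0 ▸ hx)
    refine ⟨γ, h0, ⟨fun t _ => hmem t, fun t ht => ?_⟩, hγ⟩
    simpa [hχ1 _ (hS' t ht)] using (hγ t).hasDerivWithinAt (s := Ici 0)
  have hdist : ∀ γ γ' : ℝ → E, IsForwardCurve F X γ → IsForwardCurve F X γ' → γ 0 ∈ S → γ' 0 ∈ S →
      ∀ t, 0 ≤ t → dist (γ t) (γ' t) ≤ dist (γ 0) (γ' 0) * Real.exp (K * t) := by
    intro γ γ' hγ hγ' h0 h0' t ht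
    have hd : ∀ η : ℝ → E, IsForwardCurve F X η → η 0 ∈ S → ∀ s ∈ Ico 0 t,
        HasDerivWithinAt η (χ (η s) • F (η s)) (Ici s) s := by
      intro η hη hη0 s hs
      rw [hχ1 _ (hη.mem_of_isTrapping htrap hη0 hs.1), one_smul]
      exact (hη.deriv s hs.1).mono (Ici_subset_Ici.2 hs.1)
    have := dist_le_of_trajectories_ODE (v := fun _ x => χ x • F x) (K := K) (a := 0) (b := t)
      (fun _ => hK)
      ((continuousOn_Ici_of_hasDerivWithinAt hγ.deriv).mono Icc_subset_Ici_self) (hd γ hγ h0)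
      ((continuousOn_Ici_of_hasDerivWithinAt hγ'.deriv).mono Icc_subset_Ici_self) (hd γ' hγ' h0')
      le_rfl t ⟨ht, le_rfl⟩
    simpa using this
  refine ⟨fun x hx => ?_, ⟨K, hdist⟩, fun γ hγ h0 t ht hFt => ?_⟩
  · obtain ⟨γ, h1, h2, -⟩ := hex x hx
    exact ⟨γ, h1, h2⟩
  -- The cut-off solution lives on all of `ℝ`, so a zero of the field at time `t` forces it to be
  -- constant backward in time as well.
  · obtain ⟨η, hη0, hη, hηd⟩ := hex (γ 0) h0
    have heq : ∀ s, 0 ≤ s → γ s = η s := fun s hs => by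
      have := hdist γ η hγ hη h0 (hη0 ▸ h0) s hs
      rw [hη0, dist_self, zero_mul] at this
      exact dist_le_zero.1 this
    have h1 := eq_const_of_solution hK hηd (t := t) (by rw [← heq t ht, hFt, smul_zero]) 0
    rw [hη0, ← heq t ht] at h1
    rw [h1, hFt]

end trapping

end SimplexFlow

end

/-! ### Compact sets of simplices and quantities conserved by the flow -/

noncomputable section

namespace SimplexFlow

variable {n : ℕ}

theorem continuousOn_dualVec (i : Fin (n + 1)) :
    ContinuousOn (fun x : Config n => dualVec x i) {x | homDet x ≠ 0} :=
  fun _ hx => (contDiffAt_dualVec hx i).continuousAt.continuousWithinAt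

theorem continuousOn_invInradius : ContinuousOn (invInradius (n := n)) {x | homDet x ≠ 0} :=
  continuousOn_finsetSum _ fun i _ => (continuousOn_dualVec i).norm

theorem continuous_vertex_sum : Continuous fun x : Config n => ∑ i, vertex x i :=
  continuous_finsetSum _ fun i _ => (vertexL i).continuous

/-- The simplices with volume, inradius and center of gravity in given bounds. -/
def boundedSimplices (d d' f R : ℝ) : Set (Config n) :=
  {x | d ≤ |homDet x| ∧ |homDet x| ≤ d' ∧ invInradius x ≤ f ∧ ‖∑ i, vertex x i‖ ≤ R}

theorem boundedSimplices_subset {d d' f R : ℝ} (hd : 0 < d) :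
    boundedSimplices d d' f R ⊆ {x : Config n | homDet x ≠ 0} :=
  fun _ hx => abs_pos.1 (hd.trans_le hx.1)

/-- The lower bound on the determinant comes first: on the closed set that it defines, `invInradius`
is continuous. -/
theorem isClosed_boundedSimplices {d d' f R : ℝ} (hd : 0 < d) :
    IsClosed (boundedSimplices d d' f R : Set (Config n)) := by
  have h1 : IsClosed {x : Config n | d ≤ |homDet x| ∧ |homDet x| ≤ d' ∧ ‖∑ i, vertex x i‖ ≤ R} :=
    (isClosed_le continuous_const contDiff_homDet.continuous.abs).inter
      ((isClosed_le contDiff_homDet.continuous.abs continuous_const).inter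
        (isClosed_le continuous_vertex_sum.norm continuous_const))
  have h2 := (continuousOn_invInradius.mono fun x
    (hx : x ∈ {x : Config n | d ≤ |homDet x| ∧ |homDet x| ≤ d' ∧ ‖∑ i, vertex x i‖ ≤ R}) =>
      abs_pos.1 (hd.trans_le hx.1)).preimage_isClosed_of_isClosed h1 (isClosed_Iic (a := f))
  convert h2 using 1
  ext x
  simp only [boundedSimplices, mem_inter_iff, mem_ofPred_eq, mem_preimage, mem_Iic]
  tauto

/-- The bounds on `f` and the center of gravity bound the inverse homogeneous matrix. The matrix
itself is the determinant times the adjugate of that inverse, hence bounded too. -/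
theorem isBounded_boundedSimplices {d d' f R : ℝ} (hd : 0 < d) :
    Bornology.IsBounded (boundedSimplices d d' f R : Set (Config n)) := by
  set M := 1 + max f 0 * (1 + max R 0) with hM
  have hf0 : 0 ≤ max f 0 := le_max_right _ _
  have hR0 : 0 ≤ max R 0 := le_max_right _ _
  set Q : Set (Matrix (Fin (n + 1)) (Fin (n + 1)) ℝ) :=
    Set.pi univ fun _ => Set.pi univ fun _ => Icc (-M) M with hQ
  have hQc : IsCompact Q := isCompact_univ_pi fun _ => isCompact_univ_pi fun _ => isCompact_Icc
  have hadj : ∀ i j, ∃ C, ∀ A ∈ Q, ‖A.adjugate i j‖ ≤ C := fun i j =>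
    hQc.exists_bound_of_continuousOn
      ((continuous_id.matrix_adjugate).matrix_elem i j).continuousOn
  choose C hC using hadj
  have hinv : ∀ x ∈ boundedSimplices d d' f R, (homMatrix (n := n) x)⁻¹ ∈ Q := by
    intro x hx
    have hx0 := boundedSimplices_subset hd hx
    have hb : ∀ j, ‖dualVec x j‖ ≤ max f 0 := fun j =>
      (Finset.single_le_sum (f := fun j => ‖dualVec x j‖) (fun _ _ => norm_nonneg _)
        (Finset.mem_univ j)).trans (hx.2.2.1.trans (le_max_left _ _))
    have hrow : ∀ j, |(homMatrix x)⁻¹ 0 j| ≤ M := by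
      intro j
      have h : ∀ i, (homMatrix x)⁻¹ 0 j + inner ℝ (vertex x i) (dualVec x j)
          = if i = j then 1 else 0 := fun i => by
        have h := congrFun (congrFun (Matrix.mul_nonsing_inv _ (isUnit_homMatrix_det hx0)) i) j
        rw [Matrix.mul_apply, Fin.sum_univ_succ, Matrix.one_apply] at h
        rw [← h, inner_euclidean]
        simp
      -- Summing over the vertices expresses the constant term of a barycentric coordinate through
      -- the center of gravity.
      have h2 := Finset.sum_congr rfl fun i (_ : i ∈ Finset.univ) => h i
      rw [Finset.sum_add_distrib, ← sum_inner] at h2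
      simp only [Finset.sum_const, Finset.card_univ, Fintype.card_fin, Finset.sum_ite_eq',
        Finset.mem_univ, if_true, nsmul_eq_mul, Nat.cast_add, Nat.cast_one] at h2
      have h3 : |inner ℝ (∑ i, vertex x i) (dualVec x j)| ≤ max R 0 * max f 0 :=
        (abs_real_inner_le_norm _ _).trans
          (mul_le_mul (hx.2.2.2.trans (le_max_left _ _)) (hb j) (norm_nonneg _) hR0)
      have hn1 : (1 : ℝ) ≤ n + 1 := by simp
      have h4 : |((n : ℝ) + 1) * (homMatrix x)⁻¹ 0 j| ≤ 1 + max R 0 * max f 0 := by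
        rw [eq_sub_of_add_eq h2]
        exact (abs_sub _ _).trans (by simpa using h3)
      rw [abs_mul, abs_of_pos (by linarith : (0 : ℝ) < n + 1)] at h4
      have h5 : |(homMatrix x)⁻¹ 0 j| ≤ 1 + max R 0 * max f 0 :=
        (le_mul_of_one_le_left (abs_nonneg _) hn1).trans h4
      rw [hM]
      nlinarith
    intro k _ j _
    refine abs_le.1 ?_
    refine Fin.cases (hrow j) (fun a => ?_) k
    have h1 : ‖dualVec x j a‖ ≤ ‖dualVec x j‖ := PiLp.norm_apply_le _ _
    have h2 := h1.trans (hb j)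
    rw [Real.norm_eq_abs] at h2
    refine h2.trans ?_
    rw [hM]
    nlinarith
  rw [isBounded_iff_forall_norm_le]
  refine ⟨√(∑ ij : Fin (n + 1) × Fin n, (max d' 0 * C ij.1 ij.2.succ) ^ 2), fun x hx => ?_⟩
  have hx0 := boundedSimplices_subset hd hx
  rw [EuclideanSpace.norm_eq]
  refine Real.sqrt_le_sqrt (Finset.sum_le_sum fun ij _ => ?_)
  refine pow_le_pow_left₀ (norm_nonneg _) ?_ 2
  have h1 : homMatrix x = homDet x • ((homMatrix x)⁻¹).adjugate := by
    have h2 := Matrix.nonsing_inv_nonsing_inv _ (isUnit_homMatrix_det hx0)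
    conv_lhs => rw [← h2, Matrix.inv_def, Matrix.det_nonsing_inv, Ring.inverse_eq_inv',
      inv_inv]
    rfl
  have h3 : x ij = homDet x * ((homMatrix x)⁻¹).adjugate ij.1 ij.2.succ := by
    have := congrFun (congrFun h1 ij.1) ij.2.succ
    simpa using this
  rw [h3, norm_mul]
  exact mul_le_mul (hx.2.1.trans (le_max_left _ _)) (hC _ _ _ (hinv x hx)) (norm_nonneg _)
    (le_max_right _ _)

theorem isCompact_boundedSimplices {d d' f R : ℝ} (hd : 0 < d) :
    IsCompact (boundedSimplices d d' f R : Set (Config n)) :=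
  Metric.isCompact_of_isClosed_isBounded (isClosed_boundedSimplices hd)
    (isBounded_boundedSimplices hd)

theorem sum_vertex_constrainedPull {x : Config n} (hx : homDet x ≠ 0) :
    ∑ i, vertex (constrainedPull x) i = 0 := by
  have h1 : ∑ i, vertex (pullConfig x) i = 0 := by
    simp_rw [vertex_pullConfig]
    rw [Finset.sum_comm]
    simp_rw [← Finset.sum_smul, ← Finset.sum_div, ← inner_sum, sum_dualVec hx]
    simp
  simp only [constrainedPull, vertex_sub, vertex_smul, Finset.sum_sub_distrib, h1,
    ← Finset.smul_sum, vertex_dualConfig, sum_dualVec hx, smul_zero, sub_zero]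

theorem hasDerivWithinAt_comp_of_hasGradientAt {E : Type*} [NormedAddCommGroup E]
    [InnerProductSpace ℝ E] [CompleteSpace E] {f : E → ℝ} {w : E} {γ : ℝ → E} {v : E} {s : Set ℝ}
    {t : ℝ} (hf : HasGradientAt f w (γ t)) (hγ : HasDerivWithinAt γ v s t) :
    HasDerivWithinAt (fun u => f (γ u)) (inner ℝ w v) s t :=
  (hasGradientAt_iff_hasFDerivAt.1 hf).comp_hasDerivWithinAt t hγ

section field

variable [NeZero n] {g : ℝ → ℝ} (hg : ContDiffOn ℝ ∞ g (Ioi 0))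

/-- The speed at which `invInradius` decreases along the field `inflationField g`. -/
def dissipation (g : ℝ → ℝ) (x : Config n) : ℝ :=
  deriv g (inradius x) * inradius x ^ 2 * ‖constrainedPull x‖ ^ 2

include hg

theorem inner_dualConfig_inflationField {x : Config n} (hx : homDet x ≠ 0) :
    inner ℝ (homDet x • dualConfig x) (inflationField g x) = 0 := by
  rw [inflationField_eq hg hx, real_inner_smul_left, real_inner_smul_right,
    inner_dualConfig_constrainedPull]
  simp

theorem inner_pullConfig_inflationField {x : Config n} (hx : homDet x ≠ 0) :
    inner ℝ (-pullConfig x) (inflationField g x) = -dissipation g x := by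
  rw [inflationField_eq hg hx, inner_neg_left, real_inner_smul_right,
    inner_pullConfig_constrainedPull, dissipation]

theorem sum_vertex_inflationField {x : Config n} (hx : homDet x ≠ 0) :
    ∑ i, vertex (inflationField g x) i = 0 := by
  rw [inflationField_eq hg hx]
  simp [← Finset.smul_sum, sum_vertex_constrainedPull hx]

section curve

variable {γ : ℝ → Config n} {c : ℝ → ℝ} (hX : ∀ t, 0 ≤ t → homDet (γ t) ≠ 0)
  (hγ : ∀ t, 0 ≤ t → HasDerivWithinAt γ (c t • inflationField g (γ t)) (Ici 0) t)

include hX hγ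

theorem homDet_curve {t : ℝ} (ht : 0 ≤ t) : homDet (γ t) = homDet (γ 0) := by
  refine eq_of_hasDerivWithinAt_Ici_zero (f := fun t => homDet (γ t)) (fun t ht => ?_) ht
  refine (hasDerivWithinAt_comp_of_hasGradientAt (hasGradientAt_homDet (hX t ht))
    (hγ t ht)).congr_deriv ?_
  rw [real_inner_smul_right, inner_dualConfig_inflationField hg (hX t ht), mul_zero]

theorem sum_vertex_curve {t : ℝ} (ht : 0 ≤ t) : ∑ i, vertex (γ t) i = ∑ i, vertex (γ 0) i := by
  refine eq_of_hasDerivWithinAt_Ici_zero (f := fun t => ∑ i, vertex (γ t) i) (fun t ht => ?_) ht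
  have h : ∀ i, HasDerivWithinAt (fun t => vertex (γ t) i)
      (vertex (c t • inflationField g (γ t)) i) (Ici 0) t := fun i =>
    (vertexL i).hasFDerivAt.comp_hasDerivWithinAt t (hγ t ht)
  refine (HasDerivWithinAt.fun_sum fun i _ => h i).congr_deriv ?_
  simp [← Finset.smul_sum, sum_vertex_inflationField hg (hX t ht)]

theorem hasDerivWithinAt_invInradius_curve {t : ℝ} (ht : 0 ≤ t) :
    HasDerivWithinAt (fun t => invInradius (γ t)) (-(c t * dissipation g (γ t))) (Ici 0) t := by
  refine (hasDerivWithinAt_comp_of_hasGradientAt (hasGradientAt_invInradius (hX t ht))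
    (hγ t ht)).congr_deriv ?_
  rw [real_inner_smul_right, inner_pullConfig_inflationField hg (hX t ht), mul_neg]

end curve

variable (hg' : ∀ r : ℝ, 0 < r → 0 < deriv g r)

omit hg in
include hg' in
theorem dissipation_nonneg {x : Config n} (hx : homDet x ≠ 0) : 0 ≤ dissipation g x := by
  have := hg' _ (inradius_pos hx)
  unfold dissipation
  positivity

include hg'

/-- The determinant and the sum of the vertices are conserved, and `invInradius` does not increase;
a nonnegative speed factor changes none of this. -/
theorem isTrapping_boundedSimplices {d d' f R : ℝ} :
    IsTrapping (inflationField g) {x : Config n | homDet x ≠ 0} (boundedSimplices d d' f R) := by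
  intro γ c hX hc hγ h0 t ht
  have hmono := monotoneOn_Ici_of_hasDerivWithinAt
    (fun t ht => (hasDerivWithinAt_invInradius_curve hg hX hγ ht).neg)
    (fun t ht => by
      rw [neg_neg]
      exact mul_nonneg (hc t ht) (dissipation_nonneg hg' (hX t ht))) self_mem_Ici ht ht
  have h1 := homDet_curve hg hX hγ ht
  have h2 := sum_vertex_curve hg hX hγ ht
  obtain ⟨a1, a2, a3, a4⟩ := h0
  refine ⟨h1 ▸ a1, h1 ▸ a2, le_trans (neg_le_neg_iff.1 hmono) a3, h2 ▸ a4⟩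

theorem exists_trapping_nhds {x : Config n} (hx : homDet x ≠ 0) :
    ∃ S ∈ 𝓝 x, IsCompact S ∧ S ⊆ {x : Config n | homDet x ≠ 0} ∧
      IsTrapping (inflationField g) {x : Config n | homDet x ≠ 0} S := by
  have hD : 0 < |homDet x| := abs_pos.2 hx
  refine ⟨boundedSimplices (|homDet x| / 2) (|homDet x| + 1) (invInradius x + 1)
    (‖∑ i, vertex x i‖ + 1), ?_, isCompact_boundedSimplices (by positivity),
    boundedSimplices_subset (by positivity), isTrapping_boundedSimplices hg hg'⟩
  have h1 : ∀ᶠ y in 𝓝 x, |homDet x| / 2 < |homDet y| :=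
    (contDiff_homDet.continuous.abs.tendsto x).eventually_const_lt (by linarith)
  have h2 : ∀ᶠ y in 𝓝 x, |homDet y| < |homDet x| + 1 :=
    (contDiff_homDet.continuous.abs.tendsto x).eventually_lt_const (by linarith)
  have h3 : ∀ᶠ y in 𝓝 x, invInradius y < invInradius x + 1 :=
    (contDiffAt_invInradius hx).continuousAt.eventually_lt_const (by linarith)
  have h4 : ∀ᶠ y in 𝓝 x, ‖∑ i, vertex y i‖ < ‖∑ i, vertex x i‖ + 1 :=
    (continuous_vertex_sum.norm.tendsto x).eventually_lt_const (by linarith)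
  filter_upwards [h1, h2, h3, h4] with y a1 a2 a3 a4
  exact ⟨a1.le, a2.le, a3.le, a4.le⟩

theorem inflationField_eq_zero_iff {x : Config n} (hx : homDet x ≠ 0) :
    inflationField g x = 0 ↔ shapeDefect x = 0 := by
  have h1 := hg' _ (inradius_pos hx)
  have h2 := inradius_pos hx
  rw [inflationField_eq hg hx, smul_eq_zero_iff_right (by positivity),
    constrainedPull_eq_zero_iff hx]

theorem dissipation_pos {x : Config n} (hx : homDet x ≠ 0) (h : inflationField g x ≠ 0) :
    0 < dissipation g x := by
  have h1 := hg' _ (inradius_pos hx)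
  have h2 := inradius_pos hx
  have h3 : 0 < ‖constrainedPull x‖ := by
    rw [norm_pos_iff]
    intro h0
    exact h (by rw [inflationField_eq hg hx, h0, smul_zero])
  unfold dissipation
  positivity

theorem dissipation_eq {x : Config n} (hx : homDet x ≠ 0) :
    dissipation g x / invInradius x
      = (deriv g (inradius x) * inradius x)⁻¹ * ‖inflationField g x‖ ^ 2 := by
  have h1 := hg' _ (inradius_pos hx)
  have h2 := inradius_pos hx
  rw [inflationField_eq hg hx, norm_smul, Real.norm_of_nonneg (by positivity), dissipation,
    div_eq_mul_inv, ← inradius_eq_inv hx]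
  field_simp

/-- The Łojasiewicz inequality, from `deficit_le` and `shapeDefect_le`. The factor `1 + deficit x`
covers the case where the distance to the identity is too large for `deficit_le`. -/
theorem deficit_le_inflationField {x : Config n} (hx : homDet x ≠ 0) :
    deficit x ≤ 4 * (1 + deficit x) * (n * ‖x‖ / (deriv g (inradius x) * inradius x)) ^ 2 *
      ‖inflationField g x‖ ^ 2 := by
  have h1 := hg' _ (inradius_pos hx)
  have h2 := inradius_pos hx
  have hf := invInradius_pos hx
  have h0 := deficit_nonneg hx
  have hS := shapeDefect_nonneg hx
  have h3 : (n / invInradius x) ^ 2 * shapeDefect x ≤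
      (n * ‖x‖ / (deriv g (inradius x) * inradius x)) ^ 2 * ‖inflationField g x‖ ^ 2 := by
    calc (n / invInradius x) ^ 2 * shapeDefect x
        ≤ (n / invInradius x) ^ 2 * (‖constrainedPull x‖ ^ 2 * ‖x‖ ^ 2) := by
          gcongr; exact shapeDefect_le hx
      _ = _ := by
          rw [inflationField_eq hg hx, norm_smul, Real.norm_of_nonneg (by positivity),
            div_eq_mul_inv, ← inradius_eq_inv hx]
          field_simp
  have h4 : deficit x ≤ 4 * (1 + deficit x) * ((n / invInradius x) ^ 2 * shapeDefect x) := by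
    have h5 : 0 ≤ (n / invInradius x) ^ 2 * shapeDefect x := by positivity
    rcases le_or_gt ((n / invInradius x) ^ 2 * shapeDefect x) (1 / 4) with h | h
    · nlinarith [deficit_le hx h]
    · nlinarith
  refine h4.trans ?_
  rw [mul_assoc (4 * (1 + deficit x))]
  gcongr

end field

end SimplexFlow

end

/-! ### Uniform exponential convergence -/

noncomputable section

namespace SimplexFlow

variable {n : ℕ} [NeZero n] {g : ℝ → ℝ} (hg : ContDiffOn ℝ ∞ g (Ioi 0))
  (hg' : ∀ r : ℝ, 0 < r → 0 < deriv g r)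

theorem continuousOn_deficit : ContinuousOn (deficit (n := n)) {x | homDet x ≠ 0} := by
  have hn : (0 : ℝ) < n := by exact_mod_cast NeZero.pos n
  refine (continuousOn_const.mul (continuousOn_invInradius.log fun x hx =>
    (invInradius_pos hx).ne')).sub (ContinuousOn.log ?_ fun x hx => ?_)
  · exact continuousOn_const.div (contDiff_homDet.continuous.pow 2).continuousOn
      fun x hx => pow_ne_zero 2 hx
  · exact (div_pos (by positivity) (by have : homDet x ≠ 0 := hx; positivity)).ne'

include hg in
theorem continuousOn_deriv_mul_inradius :
    ContinuousOn (fun x : Config n => deriv g (inradius x) * inradius x) {x | homDet x ≠ 0} := by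
  have h1 : ContinuousOn (inradius (n := n)) {x | homDet x ≠ 0} :=
    fun x hx => (contDiffAt_inradius hx).continuousAt.continuousWithinAt
  have h2 : ContinuousOn (deriv g) (Ioi 0) :=
    ((contDiffOn_infty_iff_deriv_of_isOpen isOpen_Ioi).1 hg).2.continuousOn
  exact (h2.comp h1 fun x hx => inradius_pos hx).mul h1

include hg hg'

theorem exists_lojasiewicz_constants {S : Set (Config n)} (hS : IsCompact S)
    (hSX : S ⊆ {x | homDet x ≠ 0}) :
    ∃ c C M : ℝ, 0 < c ∧ 0 < C ∧ ∀ x ∈ S,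
      c * ‖inflationField g x‖ ^ 2 ≤ 2 * n * (dissipation g x / invInradius x) ∧
      deficit x ≤ C * ‖inflationField g x‖ ^ 2 ∧ deficit x ≤ M := by
  have hn : (0 : ℝ) < n := by exact_mod_cast NeZero.pos n
  have hpos : ∀ x ∈ S, 0 < deriv g (inradius x) * inradius x := fun x hx =>
    mul_pos (hg' _ (inradius_pos (hSX hx))) (inradius_pos (hSX hx))
  have hcont := (continuousOn_deriv_mul_inradius hg).mono hSX
  obtain ⟨B, hB⟩ := hS.exists_bound_of_continuousOn hcont
  obtain ⟨M, hM⟩ := hS.exists_bound_of_continuousOn (continuousOn_deficit.mono hSX)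
  have hcont2 : ContinuousOn (fun x : Config n => 4 * (1 + deficit x) *
      (n * ‖x‖ / (deriv g (inradius x) * inradius x)) ^ 2) S :=
    (continuousOn_const.mul (continuousOn_const.add (continuousOn_deficit.mono hSX))).mul
      (((continuousOn_const.mul continuous_norm.continuousOn).div hcont
        fun x hx => (hpos x hx).ne').pow 2)
  obtain ⟨C, hC⟩ := hS.exists_bound_of_continuousOn hcont2
  -- The maxima with `1` keep the constants positive even when `S` is empty.
  refine ⟨2 * n * (max B 1)⁻¹, max C 1, M, by positivity, by positivity, fun x hx => ⟨?_, ?_, ?_⟩⟩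
  · rw [dissipation_eq hg hg' (hSX hx), mul_assoc]
    have h1 : deriv g (inradius x) * inradius x ≤ max B 1 :=
      (le_abs_self _).trans ((hB x hx).trans (le_max_left _ _))
    have h2 := hpos x hx
    gcongr
  · refine (deficit_le_inflationField hg hg' (hSX hx)).trans ?_
    have h1 := (le_abs_self _).trans ((hC x hx).trans (le_max_left C 1))
    gcongr
  · exact (le_abs_self _).trans (hM x hx)

/-- Integral curves that start in a compact trapping set converge exponentially fast, at a uniform
rate. -/
theorem exists_exponential_rate {S : Set (Config n)} (hS : IsCompact S)
    (hSX : S ⊆ {x | homDet x ≠ 0})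
    (htrap : IsTrapping (inflationField g) {x : Config n | homDet x ≠ 0} S) :
    ∃ A a : ℝ, 0 ≤ A ∧ 0 < a ∧ ∀ γ : ℝ → Config n,
      IsForwardCurve (inflationField g) {x | homDet x ≠ 0} γ → γ 0 ∈ S →
      ∀ s t, 0 ≤ s → s ≤ t → dist (γ t) (γ s) ≤ A * Real.exp (-a * s) := by
  have hn : (0 : ℝ) < n := by exact_mod_cast NeZero.pos n
  obtain ⟨c, C, M, hc, hC, hcon⟩ := exists_lojasiewicz_constants hg hg' hS hSX
  obtain ⟨-, ⟨K, hK⟩, hback⟩ := exists_flow_of_isTrapping isOpen_homDet_ne_zero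
    (fun x hx => contDiffAt_inflationField hg hx) hS hSX htrap
  -- The deficit decays at rate `c / C`; distances are bounded by its square root, which halves the
  -- rate.
  refine ⟨2 * √C / c * √(max M 0), c / C / 2, by positivity, by positivity, ?_⟩
  intro γ hγ h0 s t hs hst
  by_cases hF : inflationField g (γ 0) = 0
  · have hconst : ∀ t, 0 ≤ t → γ t = γ 0 := fun t ht => by
      have h1 : IsForwardCurve (inflationField g) {x | homDet x ≠ 0} fun _ => γ 0 :=
        ⟨fun _ _ => hSX h0, fun t _ => by rw [hF]; exact hasDerivWithinAt_const _ _ _⟩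
      have h2 := hK γ (fun _ => γ 0) hγ h1 h0 h0 t ht
      rw [dist_self, zero_mul] at h2
      exact dist_le_zero.1 h2
    rw [hconst t (hs.trans hst), hconst s hs, dist_self]
    positivity
  · have hmem : ∀ t, 0 ≤ t → γ t ∈ S := fun t ht => hγ.mem_of_isTrapping htrap h0 ht
    have hFt : ∀ t, 0 ≤ t → inflationField g (γ t) ≠ 0 := fun t ht h =>
      hF (hback γ hγ h0 t ht h)
    have hγ' : ∀ t, 0 ≤ t → HasDerivWithinAt γ ((1 : ℝ) • inflationField g (γ t)) (Ici 0) t :=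
      fun t ht => by simpa using hγ.deriv t ht
    have hΛ : ∀ t, 0 ≤ t → HasDerivWithinAt (fun t => deficit (γ t))
        (-(2 * n * (dissipation g (γ t) / invInradius (γ t)))) (Ici 0) t := by
      intro t ht
      have h1 : HasDerivWithinAt (fun t => 2 * n * Real.log (invInradius (γ t))
          - Real.log (n ^ n * (n + 1) ^ (n + 1) / homDet (γ 0) ^ 2))
          (2 * n * (-(1 * dissipation g (γ t)) / invInradius (γ t))) (Ici 0) t :=
        (((hasDerivWithinAt_invInradius_curve (c := fun _ => 1) hg hγ.mem hγ' ht).log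
          (invInradius_pos (hγ.mem t ht)).ne').const_mul _).sub_const _
      refine (h1.congr_deriv (by ring)).congr (fun u hu => ?_) ?_
      · rw [deficit, homDet_curve (c := fun _ => 1) hg hγ.mem hγ' hu]
      · rw [deficit, homDet_curve (c := fun _ => 1) hg hγ.mem hγ' ht]
    -- The deficit is strictly decreasing and still nonnegative at time `t + 1`.
    have hpos : ∀ t, 0 ≤ t → 0 < deficit (γ t) := by
      intro t ht
      have h1 := strictMonoOn_Ici_of_hasDerivWithinAt (fun t ht => (hΛ t ht).neg)
        (fun t ht => by
          have := dissipation_pos hg hg' (hγ.mem t ht) (hFt t ht)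
          have := invInradius_pos (hγ.mem t ht)
          rw [neg_neg]
          positivity) (mem_Ici.2 ht) (mem_Ici.2 (by linarith : (0 : ℝ) ≤ t + 1)) (by linarith)
      have h2 := deficit_nonneg (hγ.mem (t + 1) (by linarith))
      simp only [Pi.neg_apply] at h1
      linarith
    have h1 := norm_sub_le_of_lyapunov hc hγ.deriv hΛ hpos (fun t ht => (hcon _ (hmem t ht)).1)
      (fun t ht => (hcon _ (hmem t ht)).2.1) hs hst
    have h2 := lyapunov_le_exp (a := c / C) hΛ (fun t ht => by
      have h3 := (hcon _ (hmem t ht)).1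
      have h4 := (hcon _ (hmem t ht)).2.1
      calc c / C * deficit (γ t) ≤ c / C * (C * ‖inflationField g (γ t)‖ ^ 2) := by gcongr
        _ = c * ‖inflationField g (γ t)‖ ^ 2 := by field_simp
        _ ≤ _ := h3) hs
    rw [dist_eq_norm]
    refine h1.trans ?_
    rw [mul_assoc]
    refine mul_le_mul_of_nonneg_left ?_ (by positivity)
    have h5 : Real.exp (-(c / C / 2) * s) = √(Real.exp (-(c / C) * s)) := by
      rw [eq_comm, Real.sqrt_eq_iff_mul_self_eq (Real.exp_pos _).le (Real.exp_pos _).le,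
        ← Real.exp_add]
      congr 1
      ring
    rw [h5, ← Real.sqrt_mul (le_max_right _ _)]
    refine Real.sqrt_le_sqrt (h2.trans ?_)
    have h6 := ((hcon _ h0).2.2).trans (le_max_left M 0)
    gcongr

end SimplexFlow

end

/-! ### Flow lines of labeled simplices -/

noncomputable section

namespace SimplexFlow

variable {n : ℕ}

theorem tendsto_mul_exp_neg (A : ℝ) {a : ℝ} (ha : 0 < a) :
    Tendsto (fun t : ℝ≥0 => A * Real.exp (-a * t)) atTop (𝓝 0) := by
  have h : Tendsto (fun t : ℝ≥0 => -a * (t : ℝ)) atTop atBot :=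
    (NNReal.tendsto_coe_atTop.2 tendsto_id).const_mul_atTop_of_neg (neg_lt_zero.2 ha)
  simpa using (Real.tendsto_exp_atBot.comp h).const_mul A

section transport

/-- The simplex obtained by permuting the labels and applying an isometry of space. -/
def LabeledSimplex.transport
    (A : EuclideanSpace ℝ (Fin n) ≃ₗᵢ[ℝ] EuclideanSpace ℝ (Fin n)) (c : EuclideanSpace ℝ (Fin n))
    (e : Equiv.Perm (Fin (n + 1))) (x : LabeledSimplex n) : LabeledSimplex n :=
  ⟨ofVertices fun i => A (vertex x.1 (e i)) + c,
    by
      have h : AffineIndependent ℝ fun i => vertex x.1 (e i) := x.2.comp_embedding e.toEmbedding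
      let f := A.toLinearEquiv.toLinearMap.toAffineMap + AffineMap.const ℝ _ c
      have hf : Function.Injective f := fun p q h => by simpa [f] using h
      exact h.map' f hf⟩

/-- The linear part of `LabeledSimplex.transport`. -/
def transportL (A : EuclideanSpace ℝ (Fin n) ≃ₗᵢ[ℝ] EuclideanSpace ℝ (Fin n))
    (e : Equiv.Perm (Fin (n + 1))) : Config n →L[ℝ] Config n :=
  LinearMap.toContinuousLinearMap
    { toFun := fun v => ofVertices fun i => A (vertex v (e i))
      map_add' := fun v w => config_ext fun i => by simp
      map_smul' := fun r v => config_ext fun i => by simp }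

variable (A : EuclideanSpace ℝ (Fin n) ≃ₗᵢ[ℝ] EuclideanSpace ℝ (Fin n))
  (c : EuclideanSpace ℝ (Fin n)) (e : Equiv.Perm (Fin (n + 1)))

@[simp]
theorem vertex_transportL (v : Config n) (i : Fin (n + 1)) :
    vertex (transportL A e v) i = A (vertex v (e i)) := rfl

@[simp]
theorem LabeledSimplex.vertex_transport (x : LabeledSimplex n) (i : Fin (n + 1)) :
    vertex (x.transport A c e).1 i = A (vertex x.1 (e i)) + c := rfl

theorem LabeledSimplex.continuous_transport :
    Continuous (LabeledSimplex.transport A c e) :=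
  continuous_induced_rng.2
    (((transportL A e).continuous.comp continuous_subtype_val).add
      (continuous_const (y := ofVertices fun _ => c)))

end transport

variable [NeZero n] {g : ℝ → ℝ} {γ γ' : ℝ≥0 → LabeledSimplex n}

theorem IsFlowLine.isForwardCurve (h : IsFlowLine g γ) :
    IsForwardCurve (inflationField g) {x | homDet x ≠ 0} fun s => (γ s.toNNReal).1 where
  mem _ _ := (γ _).homDet_ne_zero
  deriv t ht := by
    have h1 := h t.toNNReal
    rwa [Real.coe_toNNReal _ ht] at h1

theorem IsFlowLine.continuous (h : IsFlowLine g γ) : Continuous γ := by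
  refine continuous_induced_rng.2 ?_
  have h1 := (continuousOn_Ici_of_hasDerivWithinAt h.isForwardCurve.deriv).comp_continuous
    NNReal.continuous_coe fun t => t.2
  simpa [Function.comp_def] using h1

theorem IsFlowLine.shift (h : IsFlowLine g γ) (t : ℝ≥0) : IsFlowLine g fun s => γ (s + t) := by
  intro s
  have h1 := h (s + t)
  have h2 : HasDerivWithinAt (fun u : ℝ => u + (t : ℝ)) 1 (Ici 0) (s : ℝ) :=
    ((hasDerivAt_id' (s : ℝ)).add_const _).hasDerivWithinAt
  rw [NNReal.coe_add] at h1
  have h3 := h1.scomp (s : ℝ) h2 fun u hu => add_nonneg hu t.2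
  rw [one_smul] at h3
  refine h3.congr (fun u hu => ?_) ?_
  · simp only [Function.comp_apply]
    rw [Real.toNNReal_add hu t.coe_nonneg, Real.toNNReal_coe]
  · simp only [Function.comp_apply]
    rw [Real.toNNReal_add s.coe_nonneg t.coe_nonneg, Real.toNNReal_coe, Real.toNNReal_coe]

theorem isFlowLine_const_iff {x : LabeledSimplex n} :
    IsFlowLine g (fun _ => x) ↔ inflationField g x.1 = 0 := by
  constructor
  · intro h
    exact (uniqueDiffWithinAt_Ici (0 : ℝ)).eq_deriv _ (h 0) (hasDerivWithinAt_const _ _ _)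
  · intro h t
    simpa only [h] using hasDerivWithinAt_const (t : ℝ) (Ici 0) x.1

theorem IsFlowLine.strictMono_inradius (hg : ContDiffOn ℝ ∞ g (Ioi 0))
    (hg' : ∀ r : ℝ, 0 < r → 0 < deriv g r) (h : IsFlowLine g γ)
    (h0 : ∀ t, inflationField g (γ t).1 ≠ 0) : StrictMono fun t => inradius (γ t).1 := by
  have h1 := strictMonoOn_Ici_of_hasDerivWithinAt
    (fun t ht => (hasDerivWithinAt_invInradius_curve (c := fun _ => 1) hg h.isForwardCurve.mem
      (fun t ht => by simpa using h.isForwardCurve.deriv t ht) ht).neg)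
    (fun t _ => by
      simpa using dissipation_pos hg hg' (γ t.toNNReal).homDet_ne_zero (h0 t.toNNReal))
  intro s t hst
  have h2 := h1 (mem_Ici.2 s.2) (mem_Ici.2 t.2) (NNReal.coe_lt_coe.2 hst)
  simp only [Pi.neg_apply, neg_lt_neg_iff] at h2
  change invInradius (γ (Real.toNNReal t)).1 < invInradius (γ (Real.toNNReal s)).1 at h2
  rw [Real.toNNReal_coe, Real.toNNReal_coe] at h2
  simp only [inradius_eq_inv (γ _).homDet_ne_zero]
  exact inv_strictAnti₀ (invInradius_pos (γ t).homDet_ne_zero) h2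

section

variable (hg : ContDiffOn ℝ ∞ g (Ioi 0))

include hg

theorem IsFlowLine.vol_eq (h : IsFlowLine g γ) (t : ℝ≥0) : vol (γ t).1 = vol (γ 0).1 := by
  have h1 := homDet_curve (c := fun _ => 1) hg h.isForwardCurve.mem
      (fun t ht => by simpa using h.isForwardCurve.deriv t ht) t.2
  change homDet (γ (Real.toNNReal t)).1 = homDet (γ (Real.toNNReal 0)).1 at h1
  rw [Real.toNNReal_coe, Real.toNNReal_zero] at h1
  rw [vol_eq_mul (γ 0).homDet_ne_zero, h1, div_self (γ 0).homDet_ne_zero, abs_one, one_mul]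

theorem IsFlowLine.transport (h : IsFlowLine g γ)
    (A : EuclideanSpace ℝ (Fin n) ≃ₗᵢ[ℝ] EuclideanSpace ℝ (Fin n)) (c : EuclideanSpace ℝ (Fin n))
    (e : Equiv.Perm (Fin (n + 1))) : IsFlowLine g fun t => (γ t).transport A c e := by
  intro t
  refine (((transportL A e).hasFDerivAt.comp_hasDerivWithinAt (t : ℝ) (h t)).add_const
    (ofVertices fun _ => c)).congr_deriv (config_ext fun i => ?_)
  rw [vertex_transportL]
  exact (inflationField_of_isometry (fun i => LabeledSimplex.vertex_transport A c e (γ t) i)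
    (γ t).homDet_ne_zero (LabeledSimplex.homDet_ne_zero _) hg i).symm

variable (hg' : ∀ r : ℝ, 0 < r → 0 < deriv g r)

include hg'

theorem exists_isFlowLine (x : LabeledSimplex n) :
    ∃ γ : ℝ≥0 → LabeledSimplex n, γ 0 = x ∧ IsFlowLine g γ := by
  obtain ⟨S, hS, hSc, hSX, htrap⟩ := exists_trapping_nhds hg hg' x.homDet_ne_zero
  obtain ⟨γ, h0, hγ⟩ := (exists_flow_of_isTrapping isOpen_homDet_ne_zero
    (fun x hx => contDiffAt_inflationField hg hx) hSc hSX htrap).1 x.1 (mem_of_mem_nhds hS)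
  refine ⟨fun t => ⟨γ t, (affineIndependent_iff_homDet_ne_zero _).2 (hγ.mem t t.2)⟩,
    Subtype.ext (by simpa using h0), fun t => ?_⟩
  refine (hγ.deriv t t.2).congr (fun s hs => ?_) ?_
  · simp only [Real.coe_toNNReal s hs]
  · simp only [Real.toNNReal_coe]

/-- Continuous dependence, backward uniqueness and exponential convergence of the flow lines that
start near a given simplex. -/
theorem exists_nhds_flowLine_estimates (x : LabeledSimplex n) : ∃ S ∈ 𝓝 x,
    (∃ K : ℝ≥0, ∀ γ γ' : ℝ≥0 → LabeledSimplex n, IsFlowLine g γ → IsFlowLine g γ' →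
      γ 0 ∈ S → γ' 0 ∈ S → ∀ t, dist (γ t) (γ' t) ≤ dist (γ 0) (γ' 0) * Real.exp (K * t)) ∧
    (∀ γ : ℝ≥0 → LabeledSimplex n, IsFlowLine g γ → γ 0 ∈ S →
      ∀ t, inflationField g (γ t).1 = 0 → inflationField g (γ 0).1 = 0) ∧
    (∃ A a : ℝ, 0 ≤ A ∧ 0 < a ∧ ∀ γ : ℝ≥0 → LabeledSimplex n, IsFlowLine g γ → γ 0 ∈ S →
      ∃ y, ∀ t : ℝ≥0, dist (γ t) y ≤ A * Real.exp (-a * t)) := by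
  obtain ⟨S, hS, hSc, hSX, htrap⟩ := exists_trapping_nhds hg hg' x.homDet_ne_zero
  obtain ⟨-, ⟨K, hK⟩, hback⟩ := exists_flow_of_isTrapping isOpen_homDet_ne_zero
    (fun x hx => contDiffAt_inflationField hg hx) hSc hSX htrap
  obtain ⟨A, a, hA, ha, hrate⟩ := exists_exponential_rate hg hg' hSc hSX htrap
  refine ⟨Subtype.val ⁻¹' S, continuous_subtype_val.continuousAt hS, ⟨K, ?_⟩, ?_, A, a, hA, ha, ?_⟩
  · intro γ γ' hγ hγ' h0 h0' t
    have h1 := hK _ _ hγ.isForwardCurve hγ'.isForwardCurve (by simpa using h0) (by simpa using h0')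
      t t.2
    simp only [Real.toNNReal_coe, Real.toNNReal_zero] at h1
    exact h1
  · intro γ hγ h0 t ht
    have h1 := hback _ hγ.isForwardCurve (by simpa using h0) t t.2
    simp only [Real.toNNReal_coe, Real.toNNReal_zero] at h1
    exact h1 ht
  · intro γ hγ h0
    have hmem : ∀ t, (γ t).1 ∈ S := fun t => by
      simpa using hγ.isForwardCurve.mem_of_isTrapping htrap (by simpa using h0) t.2
    have hdist : ∀ s t : ℝ≥0, s ≤ t → dist (γ s).1 (γ t).1 ≤ A * Real.exp (-a * s) := by
      intro s t hst
      have h1 := hrate _ hγ.isForwardCurve (by simpa using h0) s t s.2 hst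
      simp only [Real.toNNReal_coe] at h1
      rwa [dist_comm]
    obtain ⟨y, hy⟩ := cauchySeq_tendsto_of_complete
      (cauchySeq_of_le_tendsto_0' _ hdist (tendsto_mul_exp_neg A ha))
    -- Staying in `S` keeps the limit nondegenerate.
    have hyS : y ∈ S := hSc.isClosed.mem_of_tendsto hy (Eventually.of_forall hmem)
    refine ⟨⟨y, (affineIndependent_iff_homDet_ne_zero _).2 (hSX hyS)⟩, fun s => ?_⟩
    have h1 : Tendsto (fun t => dist (γ s).1 (γ t).1) atTop (𝓝 (dist (γ s).1 y)) :=
      tendsto_const_nhds.dist hy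
    exact le_of_tendsto h1
      ((eventually_ge_atTop s).mono fun t ht => hdist s t ht)

theorem IsFlowLine.eq_of_zero (h : IsFlowLine g γ) (h' : IsFlowLine g γ') (h0 : γ 0 = γ' 0)
    (t : ℝ≥0) : γ t = γ' t := by
  obtain ⟨S, hS, ⟨K, hK⟩, -⟩ := exists_nhds_flowLine_estimates hg hg' (γ 0)
  have h1 := hK γ γ' h h' (mem_of_mem_nhds hS) (h0 ▸ mem_of_mem_nhds hS) t
  rw [← h0, dist_self, zero_mul] at h1
  exact dist_le_zero.1 h1

end

end SimplexFlow

end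

/-! ### Completion of the flow at infinite time and passage to unlabeled simplices -/

noncomputable section

namespace SimplexFlow

section quotient

variable {n : ℕ}

theorem continuous_unlabel : Continuous (unlabel (n := n)) := continuous_quotient_mk'

/-- The saturation of an open set is the union of its preimages under relabelings. Openness ensures
that the product with the unit interval is again a quotient map. -/
theorem isOpenQuotientMap_unlabel : IsOpenQuotientMap (unlabel (n := n)) where
  surjective := Quotient.mk_surjective
  continuous := continuous_unlabel
  isOpenMap U hU := by
    have h : unlabel ⁻¹' (unlabel '' U) = ⋃ e : Equiv.Perm (Fin (n + 1)),
        LabeledSimplex.transport (LinearIsometryEquiv.refl ℝ _) 0 e ⁻¹' U := by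
      ext y
      simp only [mem_preimage, mem_image, mem_iUnion]
      constructor
      · rintro ⟨x, hx, hxy⟩
        obtain ⟨e, he⟩ := Quotient.exact hxy
        refine ⟨e⁻¹, ?_⟩
        convert hx
        refine Subtype.ext (config_ext fun i => ?_)
        simp [he]
      · rintro ⟨e, he⟩
        refine ⟨_, he, Quotient.sound ⟨e⁻¹, fun i => ?_⟩⟩
        simp
    change IsOpen (unlabel ⁻¹' (unlabel '' U))
    rw [h]
    exact isOpen_iUnion fun e => hU.preimage (LabeledSimplex.continuous_transport _ _ _)

end quotient

/-- The family of times, tending to `∞` with `N`, that agrees with `s / (1 - s)` up to time `N`. -/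
def truncatedTime (N : ℕ) (s : I) : ℝ≥0 :=
  Real.toNNReal (min (s : ℝ) (N / (N + 1)) / (1 - min (s : ℝ) (N / (N + 1))))

theorem continuous_truncatedTime (N : ℕ) : Continuous (truncatedTime N) := by
  have h1 : (N / (N + 1) : ℝ) < 1 := by
    rw [div_lt_one (by positivity)]
    linarith
  have h2 : Continuous fun s : I => min (s : ℝ) (N / (N + 1)) :=
    continuous_subtype_val.min continuous_const
  exact continuous_real_toNNReal.comp (h2.div (continuous_const.sub h2) fun s =>
    (sub_pos.2 (lt_of_le_of_lt (min_le_right _ _) h1)).ne')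

theorem truncatedTime_of_le {N : ℕ} {s : I} (h : (s : ℝ) ≤ N / (N + 1)) :
    truncatedTime N s = Real.toNNReal (s / (1 - s)) := by
  rw [truncatedTime, min_eq_left h]

theorem truncatedTime_of_ge {N : ℕ} {s : I} (h : N / (N + 1) ≤ (s : ℝ)) :
    truncatedTime N s = N := by
  have h1 : (N / (N + 1) : ℝ) / (1 - N / (N + 1)) = N := by
    field_simp
    ring
  rw [truncatedTime, min_eq_right h, h1, Real.toNNReal_natCast]

theorem natCast_le_toNNReal_div {N : ℕ} {s : I} (h : N / (N + 1) ≤ (s : ℝ)) (hs : (s : ℝ) < 1) :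
    (N : ℝ≥0) ≤ Real.toNNReal (s / (1 - s)) := by
  rw [Real.le_toNNReal_iff_coe_le (div_nonneg s.2.1 (sub_nonneg.2 s.2.2)), NNReal.coe_natCast,
    le_div_iff₀ (sub_pos.2 hs)]
  rw [div_le_iff₀ (by positivity)] at h
  linarith

section flow

variable {n : ℕ} [NeZero n] {g : ℝ → ℝ} {φ : ℝ≥0 → LabeledSimplex n → LabeledSimplex n}
  {ρ : LabeledSimplex n → LabeledSimplex n}

open Classical in
/-- The flow at time `s / (1 - s)`, with the limit map at `s = 1`. -/
def compactifiedFlow (φ : ℝ≥0 → LabeledSimplex n → LabeledSimplex n)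
    (ρ : LabeledSimplex n → LabeledSimplex n) (p : I × LabeledSimplex n) : LabeledSimplex n :=
  if (p.1 : ℝ) < 1 then φ (Real.toNNReal (p.1 / (1 - p.1))) p.2 else ρ p.2

omit [NeZero n] in
theorem compactifiedFlow_of_lt {s : I} (hs : (s : ℝ) < 1) (x : LabeledSimplex n) :
    compactifiedFlow φ ρ (s, x) = φ (Real.toNNReal (s / (1 - s))) x := if_pos hs

omit [NeZero n] in
theorem compactifiedFlow_one (x : LabeledSimplex n) : compactifiedFlow φ ρ (1, x) = ρ x :=
  if_neg (by simp)

variable (hg : ContDiffOn ℝ ∞ g (Ioi 0)) (hg' : ∀ r : ℝ, 0 < r → 0 < deriv g r)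
  (hφ0 : ∀ x, φ 0 x = x) (hφ : ∀ x, IsFlowLine g fun t => φ t x)
  (hρ : ∀ x, Tendsto (fun t => φ t x) atTop (𝓝 (ρ x)))

include hg hg' hφ0 hφ

/-- The transported trajectory is a flow line with the same start, so uniqueness applies. -/
theorem vertex_flow_of_isometry {A : EuclideanSpace ℝ (Fin n) ≃ₗᵢ[ℝ] EuclideanSpace ℝ (Fin n)}
    {c : EuclideanSpace ℝ (Fin n)} {e : Equiv.Perm (Fin (n + 1))} {x y : LabeledSimplex n}
    (h : ∀ i, vertex y.1 i = A (vertex x.1 (e i)) + c) (t : ℝ≥0) (i : Fin (n + 1)) :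
    vertex (φ t y).1 i = A (vertex (φ t x).1 (e i)) + c := by
  have h1 : φ t y = (φ t x).transport A c e :=
    (hφ y).eq_of_zero hg hg' ((hφ x).transport hg A c e) (by
    rw [hφ0, hφ0]
    exact Subtype.ext (config_ext h)) t
  rw [h1, LabeledSimplex.vertex_transport]

theorem flow_equivalent {x y : LabeledSimplex n} (h : x ≈ y) (t : ℝ≥0) : φ t x ≈ φ t y := by
  obtain ⟨e, he⟩ := h
  refine ⟨e, fun i => ?_⟩
  have := vertex_flow_of_isometry hg hg' hφ0 hφ (A := LinearIsometryEquiv.refl ℝ _) (c := 0)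
    (fun i => by simpa using he i) t i
  simpa using this

theorem continuous_flow : Continuous fun p : ℝ≥0 × LabeledSimplex n => φ p.1 p.2 := by
  rw [continuous_iff_continuousAt]
  rintro ⟨t₀, x₀⟩
  obtain ⟨S, hS, ⟨K, hK⟩, -⟩ := exists_nhds_flowLine_estimates hg hg' x₀
  have h1 : Tendsto (fun p : ℝ≥0 × LabeledSimplex n => dist p.2 x₀ * Real.exp (K * p.1) +
      dist (φ p.1 x₀) (φ t₀ x₀)) (𝓝 (t₀, x₀)) (𝓝 0) := by
    have h2 : Continuous fun p : ℝ≥0 × LabeledSimplex n => dist p.2 x₀ * Real.exp (K * p.1) +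
        dist (φ p.1 x₀) (φ t₀ x₀) := by
      have := (hφ x₀).continuous.comp (continuous_fst (X := ℝ≥0) (Y := LabeledSimplex n))
      exact ((continuous_snd.dist continuous_const).mul (Real.continuous_exp.comp
        (continuous_const.mul (NNReal.continuous_coe.comp continuous_fst)))).add
          (this.dist continuous_const)
    simpa using h2.tendsto (t₀, x₀)
  rw [ContinuousAt, tendsto_iff_dist_tendsto_zero]
  refine squeeze_zero' (Eventually.of_forall fun _ => dist_nonneg) ?_ h1
  filter_upwards [(continuous_snd (X := ℝ≥0)).continuousAt (x := (t₀, x₀)) hS] with p hp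
  refine (dist_triangle _ (φ p.1 x₀) _).trans (add_le_add_left ?_ _)
  have h3 := hK _ _ (hφ p.2) (hφ x₀) (by simpa [hφ0] using hp)
    (by simpa [hφ0] using mem_of_mem_nhds hS) p.1
  simpa only [hφ0] using h3

theorem flow_flow (s t : ℝ≥0) (x : LabeledSimplex n) : φ s (φ t x) = φ (s + t) x :=
  (hφ (φ t x)).eq_of_zero hg hg' ((hφ x).shift t) (by rw [hφ0, zero_add]) s

theorem flow_eq_self {x : LabeledSimplex n} (hx : x.IsRegular) (t : ℝ≥0) : φ t x = x := by
  refine (hφ x).eq_of_zero hg hg' (isFlowLine_const_iff.2 ?_) (hφ0 x) t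
  rw [inflationField_eq_zero_iff hg hg' x.homDet_ne_zero, ← x.isRegular_iff]
  exact hx

theorem inflationField_flow_ne_zero {x : LabeledSimplex n} (hx : ¬ x.IsRegular) (t : ℝ≥0) :
    inflationField g (φ t x).1 ≠ 0 := by
  obtain ⟨S, hS, -, hback, -⟩ := exists_nhds_flowLine_estimates hg hg' x
  intro h
  have h1 := hback _ (hφ x) (by simpa only [hφ0] using mem_of_mem_nhds hS) t h
  simp only [hφ0] at h1
  exact hx (x.isRegular_iff.2 ((inflationField_eq_zero_iff hg hg' x.homDet_ne_zero).1 h1))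

theorem exists_tendsto_flow (x : LabeledSimplex n) :
    ∃ y, Tendsto (fun t => φ t x) atTop (𝓝 y) := by
  obtain ⟨S, hS, -, -, A, a, -, ha, h⟩ := exists_nhds_flowLine_estimates hg hg' x
  obtain ⟨y, hy⟩ := h _ (hφ x) (by simpa only [hφ0] using mem_of_mem_nhds hS)
  refine ⟨y, tendsto_iff_dist_tendsto_zero.2
    (squeeze_zero (fun _ => dist_nonneg) hy (tendsto_mul_exp_neg A ha))⟩

include hρ

theorem exists_nhds_dist_limit_le (x : LabeledSimplex n) : ∃ S ∈ 𝓝 x, ∃ A a : ℝ, 0 ≤ A ∧ 0 < a ∧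
    ∀ y ∈ S, ∀ t : ℝ≥0, dist (φ t y) (ρ y) ≤ A * Real.exp (-a * t) := by
  obtain ⟨S, hS, -, -, A, a, hA, ha, h⟩ := exists_nhds_flowLine_estimates hg hg' x
  refine ⟨S, hS, A, a, hA, ha, fun y hy t => ?_⟩
  obtain ⟨z, hz⟩ := h _ (hφ y) (by simpa only [hφ0] using hy)
  have h1 : ρ y = z := tendsto_nhds_unique (hρ y) (tendsto_iff_dist_tendsto_zero.2
    (squeeze_zero (fun _ => dist_nonneg) hz (tendsto_mul_exp_neg A ha)))
  rw [h1]
  exact hz t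

/-- By continuity and the semigroup law the limit is a fixed point of the flow, hence a zero of the
field. -/
theorem limit_isRegular (x : LabeledSimplex n) : (ρ x).IsRegular := by
  have hcont := continuous_flow hg hg' hφ0 hφ
  have hfix : ∀ s, φ s (ρ x) = ρ x := fun s => by
    have h1 : Tendsto (fun t => φ s (φ t x)) atTop (𝓝 (φ s (ρ x))) :=
      ((hcont.comp (Continuous.prodMk_right s)).tendsto (ρ x)).comp (hρ x)
    simp only [flow_flow hg hg' hφ0 hφ] at h1
    exact tendsto_nhds_unique h1 ((hρ x).comp (tendsto_atTop_mono (fun _ => le_add_self) tendsto_id))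
  have h2 := hφ (ρ x)
  simp only [hfix] at h2
  rw [LabeledSimplex.isRegular_iff, ← inflationField_eq_zero_iff hg hg' (ρ x).homDet_ne_zero]
  exact isFlowLine_const_iff.1 h2

theorem limit_eq_self {x : LabeledSimplex n} (hx : x.IsRegular) : ρ x = x := by
  have h1 := hρ x
  simp only [flow_eq_self hg hg' hφ0 hφ hx] at h1
  exact tendsto_nhds_unique h1 tendsto_const_nhds

theorem limit_equivalent {x y : LabeledSimplex n} (h : x ≈ y) : ρ x ≈ ρ y := by
  obtain ⟨e, he⟩ := h
  refine ⟨e, fun i => ?_⟩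
  have h1 : ∀ (z : LabeledSimplex n) i,
      Tendsto (fun t => vertex (φ t z).1 i) atTop (𝓝 (vertex (ρ z).1 i)) := fun z i =>
    (((vertexL i).continuous.comp continuous_subtype_val).tendsto (ρ z)).comp (hρ z)
  have h2 : ∀ t, vertex (φ t y).1 i = vertex (φ t x).1 (e i) := fun t => by
    simpa using vertex_flow_of_isometry hg hg' hφ0 hφ (A := LinearIsometryEquiv.refl ℝ _) (c := 0)
      (fun i => by simpa using he i) t i
  exact tendsto_nhds_unique (h1 y i) (by simpa only [h2] using h1 x (e i))

theorem compactifiedFlow_equivalent (s : I) {x y : LabeledSimplex n} (h : x ≈ y) :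
    compactifiedFlow φ ρ (s, x) ≈ compactifiedFlow φ ρ (s, y) := by
  unfold compactifiedFlow
  split_ifs
  · exact flow_equivalent hg hg' hφ0 hφ h _
  · exact limit_equivalent hg hg' hφ0 hφ hρ h

theorem compactifiedFlow_eq_self (s : I) {x : LabeledSimplex n} (h : x.IsRegular) :
    compactifiedFlow φ ρ (s, x) = x := by
  unfold compactifiedFlow
  split_ifs
  · exact flow_eq_self hg hg' hφ0 hφ h _
  · exact limit_eq_self hg hg' hφ0 hφ hρ h

/-- It is a locally uniform limit of the flows at truncated times. These agree with it up to `s = N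
/ (N + 1)`; beyond that, both lie within `A * exp (-a * N)` of the limit `ρ x`. -/
theorem continuous_compactifiedFlow : Continuous (compactifiedFlow φ ρ) := by
  have hlim : TendstoLocallyUniformly
      (fun (N : ℕ) (p : I × LabeledSimplex n) => φ (truncatedTime N p.1) p.2)
      (compactifiedFlow φ ρ) atTop := by
    rw [Metric.tendstoLocallyUniformly_iff]
    rintro ε hε ⟨s₀, x₀⟩
    obtain ⟨S, hS, A, a, hA, ha, h⟩ := exists_nhds_dist_limit_le hg hg' hφ0 hφ hρ x₀
    refine ⟨Prod.snd ⁻¹' S, continuous_snd.continuousAt hS, ?_⟩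
    have h1 : Tendsto (fun N : ℕ => 2 * A * Real.exp (-a * (N : ℝ≥0))) atTop (𝓝 0) :=
      (tendsto_mul_exp_neg (2 * A) ha).comp tendsto_natCast_atTop_atTop
    filter_upwards [h1.eventually_lt_const hε] with N hN
    rintro ⟨s, x⟩ hx
    refine lt_of_le_of_lt ?_ hN
    have h2 := h x hx N
    rcases le_total (s : ℝ) (N / (N + 1)) with hs | hs
    · have hs1 : (s : ℝ) < 1 := lt_of_le_of_lt hs (by
        rw [div_lt_one (by positivity)]
        linarith)
      rw [compactifiedFlow_of_lt hs1, truncatedTime_of_le hs, dist_self]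
      positivity
    · rw [truncatedTime_of_ge hs, dist_comm, two_mul, add_mul]
      rcases lt_or_ge (s : ℝ) 1 with hs1 | hs1
      · rw [compactifiedFlow_of_lt hs1]
        refine (dist_triangle_right _ _ (ρ x)).trans (add_le_add h2 ((h x hx _).trans ?_))
        have h3 : ((N : ℝ≥0) : ℝ) ≤ Real.toNNReal (s / (1 - s)) :=
          NNReal.coe_le_coe.2 (natCast_le_toNNReal_div hs hs1)
        refine mul_le_mul_of_nonneg_left (Real.exp_le_exp.2 ?_) hA
        nlinarith
      · rw [compactifiedFlow, if_neg (not_lt.2 hs1)]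
        exact h2.trans (le_add_of_nonneg_right (by positivity))
  refine hlim.continuous (Eventually.of_forall fun N => ?_).frequently
  exact (continuous_flow hg hg' hφ0 hφ).comp
    (((continuous_truncatedTime N).comp continuous_fst).prodMk continuous_snd)

/-- The strong deformation retraction of the space of unlabeled simplices. -/
theorem exists_homotopyRel :
    ∃ (R : C(UnlabeledSimplex n, UnlabeledSimplex n))
      (H : ContinuousMap.HomotopyRel (ContinuousMap.id (UnlabeledSimplex n)) R
        (regularSimplices n)),
      (∀ x, R (unlabel x) = unlabel (ρ x)) ∧
      ∀ s x, H (s, unlabel x) = unlabel (compactifiedFlow φ ρ (s, x)) := by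
  let G : I × UnlabeledSimplex n → UnlabeledSimplex n := fun p =>
    Quotient.map (fun x => compactifiedFlow φ ρ (p.1, x))
      (fun _ _ h => compactifiedFlow_equivalent hg hg' hφ0 hφ hρ p.1 h) p.2
  have hG : ∀ s x, G (s, unlabel x) = unlabel (compactifiedFlow φ ρ (s, x)) := fun _ _ => rfl
  have hGc : Continuous G := by
    rw [(IsOpenQuotientMap.id.prodMap isOpenQuotientMap_unlabel).isQuotientMap.continuous_iff]
    exact continuous_unlabel.comp (continuous_compactifiedFlow hg hg' hφ0 hφ hρ)
  refine ⟨⟨fun q => G (1, q), hGc.comp (Continuous.prodMk_right 1)⟩,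
    { toFun := G
      continuous_toFun := hGc
      map_zero_left := ?_
      map_one_left := fun _ => rfl
      prop' := ?_ }, fun x => ?_, hG⟩
  · rintro ⟨x⟩
    change G (0, unlabel x) = unlabel x
    rw [hG, compactifiedFlow_of_lt (by simp)]
    simp [hφ0]
  · rintro s _ ⟨x, hx, rfl⟩
    change G (s, unlabel x) = unlabel x
    rw [hG, compactifiedFlow_eq_self hg hg' hφ0 hφ hρ s hx]
  · change G (1, unlabel x) = _
    rw [hG, compactifiedFlow_one]

end flow

end SimplexFlow

end

theorem mainTheorem9 (n : ℕ) [NeZero n] (g : ℝ → ℝ)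
    (hg : ContDiffOn ℝ ∞ g (Set.Ioi 0)) (hg' : ∀ r : ℝ, 0 < r → 0 < deriv g r) :
    -- the constrained gradient field is a genuine one: no junk gradients
    (∀ x : SimplexFlow.LabeledSimplex n,
      ContDiffAt ℝ ∞ (SimplexFlow.vol (n := n)) x.1 ∧
      ContDiffAt ℝ ∞ (SimplexFlow.inradius (n := n)) x.1 ∧
      gradient (SimplexFlow.vol (n := n)) x.1 ≠ 0) ∧
    ∃ (φ : ℝ≥0 → SimplexFlow.LabeledSimplex n → SimplexFlow.LabeledSimplex n)
      (ρ : SimplexFlow.LabeledSimplex n → SimplexFlow.LabeledSimplex n),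
      -- `φ` is the flow, defined for all times and unique
      (∀ x, φ 0 x = x ∧ SimplexFlow.IsFlowLine g (fun t => φ t x)) ∧
      (∀ γ : ℝ≥0 → SimplexFlow.LabeledSimplex n, SimplexFlow.IsFlowLine g γ →
        ∀ t, γ t = φ t (γ 0)) ∧
      -- the volume is fixed and the inradius increases
      (∀ t x, SimplexFlow.vol (φ t x).1 = SimplexFlow.vol x.1) ∧
      (∀ x, ¬ x.IsRegular → StrictMono fun t => SimplexFlow.inradius (φ t x).1) ∧
      -- the flow commutes with the isometries of space
      (∀ (T : EuclideanSpace ℝ (Fin n) ≃ᵃⁱ[ℝ] EuclideanSpace ℝ (Fin n))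
        (x y : SimplexFlow.LabeledSimplex n), (∀ i, SimplexFlow.vertex y.1 i = T (SimplexFlow.vertex x.1 i)) →
        ∀ t i, SimplexFlow.vertex (φ t y).1 i = T (SimplexFlow.vertex (φ t x).1 i)) ∧
      -- each trajectory converges to a single regular simplex
      (∀ x, (ρ x).IsRegular ∧ Tendsto (fun t => φ t x) atTop (𝓝 (ρ x))) ∧
      -- the flow descends to a strong deformation retraction of the space of unlabeled simplices
      -- onto the subspace of regular ones, time `s` of the homotopy being time `s / (1 - s)`
      -- of the flow
      ∃ (R : C(SimplexFlow.UnlabeledSimplex n, SimplexFlow.UnlabeledSimplex n))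
        (H : ContinuousMap.HomotopyRel (ContinuousMap.id (SimplexFlow.UnlabeledSimplex n)) R
          (SimplexFlow.regularSimplices n)),
        (∀ q, R q ∈ SimplexFlow.regularSimplices n) ∧
        (∀ x, R (SimplexFlow.unlabel x) = SimplexFlow.unlabel (ρ x)) ∧
        (∀ (s : I) (x : SimplexFlow.LabeledSimplex n), (s : ℝ) < 1 →
          H (s, SimplexFlow.unlabel x) =
            SimplexFlow.unlabel (φ (Real.toNNReal ((s : ℝ) / (1 - (s : ℝ)))) x)) := by
  refine ⟨fun x => ⟨SimplexFlow.contDiffAt_vol x.homDet_ne_zero,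
    SimplexFlow.contDiffAt_inradius x.homDet_ne_zero, ?_⟩, ?_⟩
  · rw [(SimplexFlow.hasGradientAt_vol x.homDet_ne_zero).gradient]
    exact smul_ne_zero (SimplexFlow.vol_pos x.homDet_ne_zero).ne'
      (SimplexFlow.dualConfig_ne_zero x.homDet_ne_zero)
  choose ψ hψ0 hψ using SimplexFlow.exists_isFlowLine (n := n) hg hg'
  obtain ⟨φ, hφ0, hφ⟩ : ∃ φ : ℝ≥0 → SimplexFlow.LabeledSimplex n → SimplexFlow.LabeledSimplex n,
      (∀ x, φ 0 x = x) ∧ ∀ x, SimplexFlow.IsFlowLine g fun t => φ t x :=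
    ⟨fun t x => ψ x t, hψ0, hψ⟩
  choose ρ hρ using SimplexFlow.exists_tendsto_flow hg hg' hφ0 hφ
  obtain ⟨R, H, hR, hH⟩ := SimplexFlow.exists_homotopyRel hg hg' hφ0 hφ hρ
  have hreg := SimplexFlow.limit_isRegular hg hg' hφ0 hφ hρ
  refine ⟨φ, ρ, fun x => ⟨hφ0 x, hφ x⟩, fun γ hγ t => ?_, fun t x => ?_, fun x hx => ?_, ?_,
    fun x => ⟨hreg x, hρ x⟩, R, H, ?_, hR, fun s x hs => ?_⟩
  · exact hγ.eq_of_zero hg hg' (hφ (γ 0)) (hφ0 _).symm t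
  · rw [(hφ x).vol_eq hg t, hφ0]
  · exact (hφ x).strictMono_inradius hg hg'
      (SimplexFlow.inflationField_flow_ne_zero hg hg' hφ0 hφ hx)
  · intro T x y h t i
    -- Splitting off the translation reduces to the equivariance lemma, with trivial relabeling.
    have hT : ∀ p, T p = T.linearIsometryEquiv p + T 0 := fun p => by
      simpa using T.map_vadd 0 p
    rw [hT]
    exact SimplexFlow.vertex_flow_of_isometry hg hg' hφ0 hφ (e := 1)
      (fun i => by rw [h, hT]; rfl) t i
  · rintro ⟨x⟩
    exact ⟨ρ x, hreg x, (hR x).symm⟩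
  · rw [hH, SimplexFlow.compactifiedFlow_of_lt hs]
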